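/- Let $T>0$, $m\ge 1$, $H\in(1/2,1)$, $\alpha\in(0,H)$ and $\gamma\in(0,2H-1)$ with $\rho:=\alpha-\gamma>0$. Let $\mathcal A_N=\{(\eta_k,\zeta_k):1\le k\le N\}$ be a finite family of exponents in $[0,1]$ such that $0\le\zeta_k\le\min(\rho,\eta_k)$ and $\eta_k>1-\alpha$ for every $k$. Let $B=(B^1,\dots,B^m)$ be a fractional Brownian motion on $[0,T]$ with Hurst parameter $H$, i.e. a centered Gaussian process with independent coordinates, each with covariance $R(s,t)=\frac12(t^{2H}+s^{2H}-|t-s|^{2H})$. Let $\mathcal H$ be the completion of the step functions on $[0,T]$ for the inner product $\langle f,g\rangle_{\mathcal H}=H(2H-1)\int_0^T\int_0^T f(u)g(v)|u-v|^{2H-2}\,du\,dv$, and let $h\mapsto B^i(h)$ (the Wiener integral) be the linear isometry from $\mathcal H$ into $L^2(\Omega)$ that extends $\mathbf 1_{[0,t]}\mapsto B^i_t$. Write $\Delta_3=\{0\le s<t<\tau\le T\}$ and $\Delta_4=\{0\le s<t<\tau'<\tau\le T\}$ and, for $(s,t,\tau)\in\Delta_3$, $$\mathbf z^{1,\tau,i}_{ts}=\int_s^t(\tau-r)^{-\gamma}\,dB^i_r:=B^i\big(r\mapsto(\tau-r)^{-\gamma}\mathbf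 1_{[s,t]}(r)\big),\qquad 1\le i\le m .$$ For $z:\Delta_3\to\mathbb R^m$, $(s,t,\tau)\mapsto z^\tau_{ts}$, put $\|z\|_{(\alpha,\gamma,\eta,\zeta)}=\|z\|_{(\alpha,\gamma),1}+\|z\|_{(\alpha,\gamma,\eta,\zeta),1,2}$, where $$\|z\|_{(\alpha,\gamma),1}=\sup_{(s,t,\tau)\in\Delta_3}\frac{|z^\tau_{ts}|}{\big[|\tau-t|^{-\gamma}|t-s|^{\alpha}\big]\wedge|t-s|^{\rho}},$$ $$\|z\|_{(\alpha,\gamma,\eta,\zeta),1,2}=\sup_{(s,t,\tau',\tau)\in\Delta_4}\frac{|z^{\tau}_{ts}-z^{\tau'}_{ts}|}{|\tau-\tau'|^{\eta}|\tau'-t|^{-(\eta-\zeta)}\Big(\big[|\tau'-t|^{-\gamma-\zeta}|t-s|^{\alpha}\big]\wedge|t-s|^{\rho-\zeta}\Big)},$$ and let $\mathcal V^{(\alpha,\gamma,\eta,\zeta)}(\Delta_3;\mathbb R^m)$ be the set of all $z$ with $\|z\|_{(\alpha,\gamma,\eta,\zeta)}<\infty$. Then the family $\mathbf z^{1}=(\mathbf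 z^{1,\tau}_{ts})_{(s,t,\tau)\in\Delta_3}$ has a version with almost surely continuous paths on $\Delta_3$, and for every such version, almost surely, $\mathbf z^1\in\mathcal V^{(\alpha,\gamma,\eta,\zeta)}(\Delta_3;\mathbb R^m)$ for all $(\eta,\zeta)\in\mathcal A_N$. Moreover, for all $(\eta,\zeta)\in\mathcal A_N$, the norm $\|\mathbf z^1\|_{(\alpha,\gamma,\eta,\zeta)}$ is measurable (with respect to the completed $\sigma$-algebra) and, for all real $p\ge1$, $$\mathbb E\big[\|\mathbf z^{1}\|_{(\alpha,\gamma,\eta,\zeta)}^{2p}\big]<\infty .$$ -/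

import Mathlib

open MeasureTheory ProbabilityTheory Filter Topology
open scoped ENNReal

noncomputable section

namespace VolterraFBM

/-! ### Volterra spaces -/

/-- The simplex `Δ₃ = {(s, t, τ) : 0 ≤ s < t < τ ≤ T}`. -/
def simplex3 (T : ℝ) : Set (ℝ × ℝ × ℝ) :=
  {x | 0 ≤ x.1 ∧ x.1 < x.2.1 ∧ x.2.1 < x.2.2 ∧ x.2.2 ≤ T}

/-- The simplex `Δ₄ = {(s, t, τ', τ) : 0 ≤ s < t < τ' < τ ≤ T}`. -/
def simplex4 (T : ℝ) : Set (ℝ × ℝ × ℝ × ℝ) :=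
  {x | 0 ≤ x.1 ∧ x.1 < x.2.1 ∧ x.2.1 < x.2.2.1 ∧ x.2.2.1 < x.2.2.2 ∧ x.2.2.2 ≤ T}

/-- `ψ¹_{(α,γ)}(τ,t,s) = [|τ-t|^{-γ} |t-s|^α] ∧ |t-s|^{α-γ}`. -/
def psi1 (α γ τ t s : ℝ) : ℝ :=
  min (|τ - t| ^ (-γ) * |t - s| ^ α) (|t - s| ^ (α - γ))

/-- `ψ^{1,2}_{(α,γ,η,ζ)}(τ,τ',t,s)
  = |τ-τ'|^η |τ'-t|^{-(η-ζ)} ([|τ'-t|^{-γ-ζ} |t-s|^α] ∧ |t-s|^{α-γ-ζ})`. -/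
def psi12 (α γ η ζ τ τ' t s : ℝ) : ℝ :=
  |τ - τ'| ^ η * |τ' - t| ^ (-(η - ζ)) *
    min (|τ' - t| ^ (-γ - ζ) * |t - s| ^ α) (|t - s| ^ (α - γ - ζ))

/-- The `1`-norm of an increment `z s t τ = z^τ_{ts}` on `Δ₃`, as an extended nonnegative real. -/
def volterraNorm1 {E : Type*} [NormedAddCommGroup E] (T α γ : ℝ) (z : ℝ → ℝ → ℝ → E) : ℝ≥0∞ :=
  ⨆ x ∈ simplex3 T, ‖z x.1 x.2.1 x.2.2‖ₑ / ENNReal.ofReal (psi1 α γ x.2.2 x.2.1 x.1)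

/-- The `(1,2)`-norm: the supremum over `(s, t, τ', τ) ∈ Δ₄` of
`|z^τ_{ts} - z^{τ'}_{ts}| / ψ^{1,2}(τ,τ',t,s)`. -/
def volterraNorm12 {E : Type*} [NormedAddCommGroup E] (T α γ η ζ : ℝ)
    (z : ℝ → ℝ → ℝ → E) : ℝ≥0∞ :=
  ⨆ x ∈ simplex4 T, ‖z x.1 x.2.1 x.2.2.2 - z x.1 x.2.1 x.2.2.1‖ₑ /
    ENNReal.ofReal (psi12 α γ η ζ x.2.2.2 x.2.2.1 x.2.1 x.1)

/-- The Volterra norm `‖z‖_{(α,γ,η,ζ)}`. -/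
def volterraNorm {E : Type*} [NormedAddCommGroup E] (T α γ η ζ : ℝ)
    (z : ℝ → ℝ → ℝ → E) : ℝ≥0∞ :=
  volterraNorm1 T α γ z + volterraNorm12 T α γ η ζ z

/-- The Volterra space `𝒱^{(α,γ,η,ζ)}(Δ₃; E)` of increments with finite Volterra norm
(only the values on `Δ₃` matter). -/
def volterraSpace (E : Type*) [NormedAddCommGroup E] (T α γ η ζ : ℝ) :
    Set (ℝ → ℝ → ℝ → E) :=
  {z | volterraNorm T α γ η ζ z < ∞}

/-! ### Fractional Brownian motion and its Wiener integral -/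

/-- `B` is a standard `m`-dimensional fractional Brownian motion on `[0,T]` with Hurst parameter
`H`: a centered Gaussian process with independent coordinates, each of which has covariance
`R(s,t) = (t^{2H} + s^{2H} - |t-s|^{2H}) / 2`. -/
structure IsFBM {Ω : Type*} [MeasurableSpace Ω] (P : Measure Ω) (H T : ℝ) {m : ℕ}
    (B : Set.Icc (0 : ℝ) T → Ω → EuclideanSpace ℝ (Fin m)) : Prop where
  gaussian : IsGaussianProcess B P
  centered : ∀ t i, ∫ ω, B t ω i ∂P = 0
  indep : iIndepFun (fun (i : Fin m) (ω : Ω) (t : Set.Icc (0 : ℝ) T) => B t ω i) P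
  covariance : ∀ s t i, cov[fun ω => B s ω i, fun ω => B t ω i; P] =
    (|(t : ℝ)| ^ (2 * H) + |(s : ℝ)| ^ (2 * H) - |(t : ℝ) - (s : ℝ)| ^ (2 * H)) / 2

/-- The step function `∑ₜ cₜ 1_{[0,t]}` with finitely many nonzero coefficients. -/
def stepFun {T : ℝ} (c : Set.Icc (0 : ℝ) T →₀ ℝ) (r : ℝ) : ℝ :=
  c.sum fun t a => a * (Set.Icc (0 : ℝ) t).indicator (fun _ => (1 : ℝ)) r

/-- The Wiener integral `∑ₜ cₜ b_t` of the step function `∑ₜ cₜ 1_{[0,t]}`. -/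
def stepIntegral {Ω : Type*} {T : ℝ} (b : Set.Icc (0 : ℝ) T → Ω → ℝ)
    (c : Set.Icc (0 : ℝ) T →₀ ℝ) (ω : Ω) : ℝ :=
  c.sum fun t a => a * b t ω

/-- The inner product
`⟨f, g⟩_ℋ = H (2H - 1) ∫₀ᵀ ∫₀ᵀ f(u) g(v) |u - v|^{2H - 2} du dv`. -/
def innerH (H T : ℝ) (f g : ℝ → ℝ) : ℝ :=
  H * (2 * H - 1) * ∫ v in Set.Icc 0 T, ∫ u in Set.Icc 0 T, f u * g v * |u - v| ^ (2 * H - 2)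

/-- The space `|ℋ|` of measurable functions on `[0,T]` for which the double integral
defining `⟨f, f⟩_ℋ` converges absolutely. -/
def MemAbsH (H T : ℝ) (f : ℝ → ℝ) : Prop :=
  AEMeasurable f (volume.restrict (Set.Icc 0 T)) ∧
    ∫⁻ v in Set.Icc 0 T, ∫⁻ u in Set.Icc 0 T,
      ENNReal.ofReal (|f u| * |f v| * |u - v| ^ (2 * H - 2)) < ∞

/-- `X` is (a representative of) the Wiener integral `b(h)` of a function `h ∈ |ℋ| ⊆ ℋ`: the image
of `h` under the extension of `1_{[0,t]} ↦ b_t` to an isometry from the completion `ℋ` of the step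
functions into `L²(Ω)`. That is, `X` is the `L²(Ω)`-limit of the integrals of step functions which
converge to `h` in the norm of `ℋ`. -/
def IsWienerIntegral {Ω : Type*} [MeasurableSpace Ω] (P : Measure Ω) (H T : ℝ)
    (b : Set.Icc (0 : ℝ) T → Ω → ℝ) (h : ℝ → ℝ) (X : Ω → ℝ) : Prop :=
  MemAbsH H T h ∧ MemLp X 2 P ∧ ∃ c : ℕ → (Set.Icc (0 : ℝ) T →₀ ℝ),
    Tendsto (fun n => innerH H T (h - stepFun (c n)) (h - stepFun (c n))) atTop (𝓝 0) ∧
    Tendsto (fun n => eLpNorm (X - stepIntegral b (c n)) 2 P) atTop (𝓝 0)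

/-- `h^τ_{ts}(r) = (τ - r)^{-γ} 1_{[s,t]}(r)`. -/
def kernel (γ s t τ : ℝ) : ℝ → ℝ :=
  (Set.Icc s t).indicator fun r => (τ - r) ^ (-γ)

/-- `z` is a version, with almost surely continuous paths on `Δ₃`, of the first level
`z^{1,τ,i}_{ts} = ∫_s^t (τ - r)^{-γ} dB^i_r`, `(s,t,τ) ∈ Δ₃`, where for each fixed `(s,t,τ)` the
integral is a Wiener integral (hence determined up to a null set). -/
structure IsFirstLevel {Ω : Type*} [MeasurableSpace Ω] (P : Measure Ω) (H T γ : ℝ) {m : ℕ}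
    (B : Set.Icc (0 : ℝ) T → Ω → EuclideanSpace ℝ (Fin m))
    (z : Ω → ℝ → ℝ → ℝ → EuclideanSpace ℝ (Fin m)) : Prop where
  wiener : ∀ s t τ, (s, t, τ) ∈ simplex3 T → ∀ i,
    IsWienerIntegral P H T (fun r ω => B r ω i) (kernel γ s t τ) (fun ω => z ω s t τ i)
  continuous : ∀ᵐ ω ∂P,
    ContinuousOn (fun x : ℝ × ℝ × ℝ => z ω x.1 x.2.1 x.2.2) (simplex3 T)

end VolterraFBM

end

namespace VolterraFBM

/-!
Fix `a ∈ (α, H)`. All moments of `B_t - B_s` are controlled by its variance, so dyadic chaining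
yields a version of `B` which is `a`-Hölder with a random constant `K` having moments of every
order. For such a path the integral `∫_s^t (τ-r)^{-γ} dB_r` exists pathwise: integration by parts
moves the differential onto the smooth kernel and leaves

`(τ-s)^{-γ} (B_t - B_s) + ∫_s^t γ (τ-r)^{-γ-1} (B_t - B_r) dr`,

which is continuous on `Δ₃`. Bounding `|B_t - B_r|` by `K (t-r)^a`, and in the `(1,2)`-norm also the
difference of the kernels by `|τ-τ'|^η |τ'-t|^{-(η-ζ)} (τ'-r)^{-γ-ζ}`, gives a Volterra norm of at
most a deterministic multiple of `K`.

Left-point Riemann sums converge to the pathwise integral surely, and they are Wiener integrals of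
step functions converging uniformly, hence in `ℋ`, to the kernel; so the pathwise integral is a
version of the Wiener integral. Two continuous versions agree almost surely at each point of a
countable dense subset of `Δ₃`, hence everywhere on `Δ₃`, so the estimates hold for every version.
-/

/-! ### Power kernels -/

section PowerKernel

variable {s t σ τ τ' T q α a γ η ζ : ℝ}

lemma rpow_neg_sub_rpow_neg_le {x d p : ℝ} (hx : 0 < x) (hd : 0 < d) (hp : 0 < p)
    (hη : η ∈ Set.Icc (0 : ℝ) 1) :
    x ^ (-p) - (x + d) ^ (-p) ≤ max 1 p * (d ^ η * x ^ (-p - η)) := by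
  have hy : 0 < d / x := div_pos hd hx
  have factor_left : (x + d) ^ (-p) = x ^ (-p) * (1 + d / x) ^ (-p) := by
    rw [← Real.mul_rpow hx.le (by positivity)]
    congr 1
    field_simp
  have factor_right : d ^ η * x ^ (-p - η) = x ^ (-p) * (d / x) ^ η := by
    rw [Real.div_rpow hd.le hx.le, Real.rpow_sub hx]
    ring
  have bernoulli : 1 - p * (d / x) ≤ (1 + d / x) ^ (-p) := by
    have hlog : Real.log (1 + d / x) ≤ d / x := by
      linarith [Real.log_le_sub_one_of_pos (show 0 < 1 + d / x by positivity)]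
    calc 1 - p * (d / x) ≤ Real.log (1 + d / x) * -p + 1 := by nlinarith
      _ ≤ Real.exp (Real.log (1 + d / x) * -p) := Real.add_one_le_exp _
      _ = (1 + d / x) ^ (-p) := (Real.rpow_def_of_pos (by positivity) _).symm
  have scaled : 1 - (1 + d / x) ^ (-p) ≤ max 1 p * (d / x) ^ η := by
    have hpos : 0 < (1 + d / x) ^ (-p) := by positivity
    rcases le_total (d / x) 1 with h | h
    · calc 1 - (1 + d / x) ^ (-p) ≤ p * (d / x) := by linarith
        _ ≤ max 1 p * (d / x) ^ η := by
          gcongr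
          · exact le_max_right _ _
          · simpa using Real.rpow_le_rpow_of_exponent_ge hy h hη.2
    · calc 1 - (1 + d / x) ^ (-p) ≤ 1 * 1 := by linarith
        _ ≤ max 1 p * (d / x) ^ η := by
          gcongr
          · exact le_max_left _ _
          · exact Real.one_le_rpow h hη.1
  calc x ^ (-p) - (x + d) ^ (-p) = x ^ (-p) * (1 - (1 + d / x) ^ (-p)) := by
        rw [factor_left]; ring
    _ ≤ x ^ (-p) * (max 1 p * (d / x) ^ η) := by gcongr
    _ = max 1 p * (d ^ η * x ^ (-p - η)) := by rw [factor_right]; ring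

lemma abs_sub_rpow_neg_sub_sub_rpow_neg_le {p r : ℝ} (hp : 0 < p) (hη : η ∈ Set.Icc (0 : ℝ) 1)
    (hζη : ζ ≤ η) (hrt : r ≤ t) (htτ' : t < τ') (hτ : τ' < τ) :
    |(τ' - r) ^ (-p) - (τ - r) ^ (-p)| ≤
      max 1 p * ((τ - τ') ^ η * (τ' - t) ^ (-(η - ζ))) * (τ' - r) ^ (-p - ζ) := by
  have hr0 : 0 < τ' - r := by linarith
  have hd : 0 < τ - τ' := sub_pos.2 hτ
  have htrade : (τ' - r) ^ (-p - η) ≤ (τ' - t) ^ (-(η - ζ)) * (τ' - r) ^ (-p - ζ) := by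
    calc (τ' - r) ^ (-p - η) = (τ' - r) ^ (-(η - ζ)) * (τ' - r) ^ (-p - ζ) := by
          rw [← Real.rpow_add hr0]; ring_nf
      _ ≤ (τ' - t) ^ (-(η - ζ)) * (τ' - r) ^ (-p - ζ) :=
        mul_le_mul_of_nonneg_right
          (Real.rpow_le_rpow_of_nonpos (by linarith) (by linarith) (by linarith)) (by positivity)
  calc |(τ' - r) ^ (-p) - (τ - r) ^ (-p)| = (τ' - r) ^ (-p) - (τ - r) ^ (-p) :=
        abs_of_nonneg (sub_nonneg.2
          (Real.rpow_le_rpow_of_nonpos hr0 (by linarith) (by linarith)))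
    _ ≤ max 1 p * ((τ - τ') ^ η * (τ' - r) ^ (-p - η)) := by
      simpa using rpow_neg_sub_rpow_neg_le hr0 hd hp hη
    _ ≤ max 1 p * ((τ - τ') ^ η * ((τ' - t) ^ (-(η - ζ)) * (τ' - r) ^ (-p - ζ))) := by gcongr
    _ = _ := by ring

lemma rpow_le_mul_rpow_of_le {x : ℝ} (hx : 0 < x) (hxT : x ≤ T) (h : α ≤ a) :
    x ^ a ≤ T ^ (a - α) * x ^ α := by
  calc x ^ a = x ^ (a - α) * x ^ α := by rw [← Real.rpow_add hx, sub_add_cancel]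
    _ ≤ T ^ (a - α) * x ^ α := by gcongr

lemma psi1_of_lt (hst : s < t) (htσ : t < σ) :
    psi1 α q σ t s = min ((σ - t) ^ (-q) * (t - s) ^ α) ((t - s) ^ (α - q)) := by
  rw [psi1, abs_of_pos (sub_pos.2 hst), abs_of_pos (sub_pos.2 htσ)]

lemma psi12_of_lt (htτ' : t < τ') (hτ : τ' < τ) :
    psi12 α γ η ζ τ τ' t s =
      (τ - τ') ^ η * (τ' - t) ^ (-(η - ζ)) * psi1 α (γ + ζ) τ' t s := by
  rw [psi12, psi1, abs_of_pos (sub_pos.2 htτ'), abs_of_pos (sub_pos.2 hτ), neg_add', sub_sub]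

lemma psi1_pos (hst : s < t) (htσ : t < σ) : 0 < psi1 α q σ t s := by
  rw [psi1_of_lt hst htσ]
  exact lt_min (by positivity) (by positivity)

lemma psi12_pos (hst : s < t) (htτ' : t < τ') (hτ : τ' < τ) : 0 < psi12 α γ η ζ τ τ' t s := by
  have := psi1_pos (α := α) (q := γ + ζ) hst htτ'
  rw [psi12_of_lt htτ' hτ]
  positivity

lemma le_mul_psi1 {A C : ℝ} (hst : s < t) (htσ : t < σ) (hT : t - s ≤ T) (hαa : α ≤ a)
    (hC : 0 ≤ C) (hleft : A ≤ C * ((σ - t) ^ (-q) * (t - s) ^ a))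
    (hright : A ≤ C * (t - s) ^ (a - q)) :
    A ≤ C * T ^ (a - α) * psi1 α q σ t s := by
  have hts : 0 < t - s := sub_pos.2 hst
  have hT0 : 0 < T := hts.trans_le hT
  rw [psi1_of_lt hst htσ, mul_min_of_nonneg _ _ (by positivity)]
  refine le_min ?_ ?_
  · calc A ≤ C * ((σ - t) ^ (-q) * (t - s) ^ a) := hleft
      _ ≤ C * ((σ - t) ^ (-q) * (T ^ (a - α) * (t - s) ^ α)) := by
        gcongr
        exact rpow_le_mul_rpow_of_le hts hT hαa
      _ = C * T ^ (a - α) * ((σ - t) ^ (-q) * (t - s) ^ α) := by ring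
  · calc A ≤ C * (t - s) ^ (a - q) := hright
      _ ≤ C * (T ^ (a - q - (α - q)) * (t - s) ^ (α - q)) := by
        gcongr
        exact rpow_le_mul_rpow_of_le hts hT (by linarith)
      _ = C * T ^ (a - α) * (t - s) ^ (α - q) := by rw [sub_sub_sub_cancel_right, mul_assoc]

lemma rpow_mul_rpow_le_psi1 (hst : s < t) (htσ : t < σ) (hT : t - s ≤ T) (hq : 0 < q)
    (hαa : α ≤ a) :
    (σ - s) ^ (-q) * (t - s) ^ a ≤ T ^ (a - α) * psi1 α q σ t s := by
  have hts : 0 < t - s := sub_pos.2 hst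
  have hσt : 0 < σ - t := sub_pos.2 htσ
  rw [← one_mul (T ^ _)]
  refine le_mul_psi1 hst htσ hT hαa zero_le_one ?_ ?_
  · rw [one_mul]
    exact mul_le_mul_of_nonneg_right
      (Real.rpow_le_rpow_of_nonpos hσt (by linarith) (by linarith)) (by positivity)
  · calc (σ - s) ^ (-q) * (t - s) ^ a ≤ (t - s) ^ (-q) * (t - s) ^ a :=
          mul_le_mul_of_nonneg_right
            (Real.rpow_le_rpow_of_nonpos hts (by linarith) (by linarith)) (by positivity)
      _ = 1 * (t - s) ^ (a - q) := by rw [← Real.rpow_add hts, one_mul, neg_add_eq_sub]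

lemma hasDerivAt_sub_rpow {r p : ℝ} (h : r < σ) :
    HasDerivAt (fun r => (σ - r) ^ p) (-p * (σ - r) ^ (p - 1)) r := by
  simpa using ((hasDerivAt_id' r).const_sub σ).rpow_const (p := p) (Or.inl (sub_pos.2 h).ne')

lemma continuousOn_sub_rpow {p : ℝ} (hst : s ≤ t) (htσ : t < σ) :
    ContinuousOn (fun r => (σ - r) ^ p) (Set.uIcc s t) := by
  rw [Set.uIcc_of_le hst]
  exact fun r hr =>
    (hasDerivAt_sub_rpow (hr.2.trans_lt htσ)).continuousAt.continuousWithinAt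

lemma integral_mul_sub_rpow (hst : s ≤ t) (htσ : t < σ) :
    ∫ r in s..t, q * (σ - r) ^ (-q - 1) = (σ - t) ^ (-q) - (σ - s) ^ (-q) := by
  have hint : IntervalIntegrable (fun r => q * (σ - r) ^ (-q - 1)) volume s t :=
    (continuousOn_const.mul (continuousOn_sub_rpow hst htσ)).intervalIntegrable
  refine intervalIntegral.integral_eq_sub_of_hasDerivAt (f := fun r => (σ - r) ^ (-q))
    (fun r hr => ?_) hint
  rw [Set.uIcc_of_le hst] at hr
  simpa using hasDerivAt_sub_rpow (p := -q) (hr.2.trans_lt htσ)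

lemma intervalIntegrable_sub_rpow_mul_sub_rpow (hst : s ≤ t) (htσ : t < σ) (ha : 0 ≤ a) :
    IntervalIntegrable (fun r => (σ - r) ^ (-q - 1) * (t - r) ^ a) volume s t :=
  ((continuousOn_sub_rpow hst htσ).mul
    ((continuous_const.sub continuous_id).rpow_const fun _ => Or.inr ha).continuousOn
    ).intervalIntegrable

lemma integral_sub_rpow_mul_sub_rpow_le_left (hst : s ≤ t) (htσ : t < σ) (hq : 0 < q)
    (ha : 0 ≤ a) :
    ∫ r in s..t, (σ - r) ^ (-q - 1) * (t - r) ^ a ≤ 1 / q * ((σ - t) ^ (-q) * (t - s) ^ a) := by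
  have hpointwise : ∀ r ∈ Set.Icc s t, (σ - r) ^ (-q - 1) * (t - r) ^ a ≤
      q * (σ - r) ^ (-q - 1) * (1 / q * (t - s) ^ a) := by
    rintro r ⟨hsr, hrt⟩
    have hσr : 0 < σ - r := by linarith
    calc (σ - r) ^ (-q - 1) * (t - r) ^ a ≤ (σ - r) ^ (-q - 1) * (t - s) ^ a := by
          gcongr
      _ = q * (σ - r) ^ (-q - 1) * (1 / q * (t - s) ^ a) := by field_simp
  calc ∫ r in s..t, (σ - r) ^ (-q - 1) * (t - r) ^ a
      ≤ ∫ r in s..t, q * (σ - r) ^ (-q - 1) * (1 / q * (t - s) ^ a) :=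
        intervalIntegral.integral_mono_on hst
          (intervalIntegrable_sub_rpow_mul_sub_rpow hst htσ ha)
          ((continuousOn_const.mul (continuousOn_sub_rpow hst htσ)).mul
            continuousOn_const).intervalIntegrable hpointwise
    _ = ((σ - t) ^ (-q) - (σ - s) ^ (-q)) * (1 / q * (t - s) ^ a) := by
        rw [intervalIntegral.integral_mul_const, integral_mul_sub_rpow hst htσ]
    _ ≤ (σ - t) ^ (-q) * (1 / q * (t - s) ^ a) := by
        gcongr
        exact sub_le_self _ (Real.rpow_nonneg (by linarith) _)
    _ = 1 / q * ((σ - t) ^ (-q) * (t - s) ^ a) := by ring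

lemma integral_sub_rpow_mul_sub_rpow_le_right (hst : s ≤ t) (htσ : t < σ) (hq : 0 < q)
    (hqa : q < a) :
    ∫ r in s..t, (σ - r) ^ (-q - 1) * (t - r) ^ a ≤ 1 / (a - q) * (t - s) ^ (a - q) := by
  have hpointwise : ∀ r ∈ Set.Ioo s t, (σ - r) ^ (-q - 1) * (t - r) ^ a ≤
      (t - r) ^ (a - q - 1) := by
    rintro r ⟨-, hrt⟩
    have htr : 0 < t - r := sub_pos.2 hrt
    calc (σ - r) ^ (-q - 1) * (t - r) ^ a ≤ (t - r) ^ (-q - 1) * (t - r) ^ a :=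
          mul_le_mul_of_nonneg_right
            (Real.rpow_le_rpow_of_nonpos htr (by linarith) (by linarith)) (by positivity)
      _ = (t - r) ^ (a - q - 1) := by rw [← Real.rpow_add htr]; ring_nf
  have hint : IntervalIntegrable (fun r => (t - r) ^ (a - q - 1)) volume s t := by
    simpa using (intervalIntegral.intervalIntegrable_rpow' (a := t - s) (b := t - t)
      (r := a - q - 1) (by linarith)).comp_sub_left t
  calc ∫ r in s..t, (σ - r) ^ (-q - 1) * (t - r) ^ a ≤ ∫ r in s..t, (t - r) ^ (a - q - 1) :=
        intervalIntegral.integral_mono_on_of_le_Ioo hst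
          (intervalIntegrable_sub_rpow_mul_sub_rpow hst htσ (hq.trans hqa).le) hint hpointwise
    _ = 1 / (a - q) * (t - s) ^ (a - q) := by
        rw [intervalIntegral.integral_comp_sub_left (fun r => r ^ (a - q - 1)) t,
          integral_rpow (Or.inl (by linarith)), sub_self, sub_add_cancel,
          Real.zero_rpow (sub_pos.2 hqa).ne', sub_zero, one_div_mul_eq_div]

lemma integral_sub_rpow_mul_sub_rpow_le_psi1 (hst : s < t) (htσ : t < σ) (hT : t - s ≤ T)
    (hq : 0 < q) (hqa : q < a) (hαa : α ≤ a) :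
    ∫ r in s..t, (σ - r) ^ (-q - 1) * (t - r) ^ a ≤
      (1 / q + 1 / (a - q)) * T ^ (a - α) * psi1 α q σ t s := by
  have ha : 0 < a := hq.trans hqa
  refine le_mul_psi1 hst htσ hT hαa (by positivity)
    ((integral_sub_rpow_mul_sub_rpow_le_left hst.le htσ hq ha.le).trans ?_)
    ((integral_sub_rpow_mul_sub_rpow_le_right hst.le htσ hq hqa).trans ?_)
  · gcongr
    exact le_add_of_nonneg_right (by positivity)
  · gcongr
    exact le_add_of_nonneg_left (by positivity)

end PowerKernel

/-! ### Young integrals of power kernels -/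

section Young

open scoped NNReal

variable {E : Type*} [NormedAddCommGroup E] {x : ℝ → E} {K a : ℝ≥0}
  {s t σ τ τ' T α γ q η ζ : ℝ}

lemma norm_sub_le_of_holderWith (hx : HolderWith K a x) {r : ℝ} (hrt : r ≤ t) :
    ‖x t - x r‖ ≤ K * (t - r) ^ (a : ℝ) := by
  simpa only [dist_eq_norm, Real.norm_of_nonneg (sub_nonneg.2 hrt)] using hx.dist_le t r

variable [NormedSpace ℝ E]

/-- The Young integral `∫_s^t (τ-r)^{-γ} dx_r`. Integration by parts is its definition, so that it
makes sense for every continuous path. -/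
noncomputable def pathIntegral (γ : ℝ) (x : ℝ → E) (s t τ : ℝ) : E :=
  (τ - t) ^ (-γ) • x t - (τ - s) ^ (-γ) • x s -
    ∫ r in s..t, (γ * (τ - r) ^ (-γ - 1)) • x r

lemma intervalIntegrable_sub_rpow_smul {p : ℝ} (hx : Continuous x) (hst : s ≤ t) (htτ : t < τ) :
    IntervalIntegrable (fun r => (γ * (τ - r) ^ p) • x r) volume s t :=
  ((continuousOn_const.mul (continuousOn_sub_rpow hst htτ)).smul
    hx.continuousOn).intervalIntegrable

lemma pathIntegral_add_pathIntegral {u v w : ℝ} (hx : Continuous x) (huv : u ≤ v) (hvw : v ≤ w)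
    (hwτ : w < τ) :
    pathIntegral γ x u v τ + pathIntegral γ x v w τ = pathIntegral γ x u w τ := by
  simp only [pathIntegral]
  rw [← intervalIntegral.integral_add_adjacent_intervals
    (intervalIntegrable_sub_rpow_smul hx huv (hvw.trans_lt hwτ))
    (intervalIntegrable_sub_rpow_smul hx hvw hwτ)]
  abel

lemma continuousOn_integral_sub_rpow_smul {p : ℝ} (hx : Continuous x) :
    ContinuousOn (fun y : ℝ × ℝ × ℝ => ∫ r in y.1..y.2.1, (γ * (y.2.2 - r) ^ p) • x r)
      (simplex3 T) := by
  rw [continuousOn_iff_continuous_domRestrict]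
  have hs : Continuous fun y : simplex3 T => y.1.1 := by fun_prop
  have ht : Continuous fun y : simplex3 T => y.1.2.1 := by fun_prop
  -- Truncating `τ - r` below by `τ - t` does not change the integrand on `[s,t]`, and it removes
  -- the singularity at `r = τ`.
  let F : simplex3 T → ℝ → E := fun y r =>
    (γ * (max (y.1.2.2 - r) (y.1.2.2 - y.1.2.1)) ^ p) • x r
  have hF : Continuous (Function.uncurry F) := by
    refine (continuous_const.mul (Continuous.rpow_const ?_ fun y => Or.inl ?_)).smul
      (hx.comp continuous_snd)
    · fun_prop
    · exact (lt_max_of_lt_right (sub_pos.2 y.1.2.2.2.1)).ne'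
  have hFint : ∀ (y : simplex3 T) (u v : ℝ), IntervalIntegrable (F y) volume u v :=
    fun y u v => (hF.comp (Continuous.prodMk_right y)).intervalIntegrable _ _
  have heq : ∀ y : simplex3 T, ∫ r in y.1.1..y.1.2.1, (γ * (y.1.2.2 - r) ^ p) • x r =
      (∫ r in (0 : ℝ)..y.1.2.1, F y r) - ∫ r in (0 : ℝ)..y.1.1, F y r := by
    intro y
    rw [intervalIntegral.integral_interval_sub_left (hFint y _ _) (hFint y _ _)]
    refine intervalIntegral.integral_congr fun r hr => ?_
    rw [Set.uIcc_of_le y.2.2.1.le] at hr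
    simp only [F]
    rw [max_eq_left (by linarith [hr.2])]
  refine Continuous.congr ?_ fun y => (heq y).symm
  exact (intervalIntegral.continuous_parametric_intervalIntegral_of_continuous hF ht).sub
    (intervalIntegral.continuous_parametric_intervalIntegral_of_continuous hF hs)

lemma continuousOn_pathIntegral (hx : Continuous x) :
    ContinuousOn (fun y : ℝ × ℝ × ℝ => pathIntegral γ x y.1 y.2.1 y.2.2) (simplex3 T) := by
  have ht : ContinuousOn (fun y : ℝ × ℝ × ℝ => (y.2.2 - y.2.1) ^ (-γ)) (simplex3 T) :=
    ContinuousOn.rpow_const (by fun_prop) fun y hy => Or.inl (sub_pos.2 hy.2.2.1).ne'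
  have hs : ContinuousOn (fun y : ℝ × ℝ × ℝ => (y.2.2 - y.1) ^ (-γ)) (simplex3 T) :=
    ContinuousOn.rpow_const (by fun_prop) fun y hy =>
      Or.inl (sub_pos.2 (hy.2.1.trans hy.2.2.1)).ne'
  exact ((ht.smul (by fun_prop)).sub (hs.smul (by fun_prop))).sub
    (continuousOn_integral_sub_rpow_smul hx)

lemma norm_integral_smul_sub_le {D : ℝ} {G : ℝ → ℝ} (hx : HolderWith K a x) (hst : s ≤ t)
    (htσ : t < σ) (hG : ∀ r ∈ Set.Icc s t, |G r| ≤ D * (σ - r) ^ (-q - 1)) :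
    ‖∫ r in s..t, G r • (x t - x r)‖ ≤
      D * K * ∫ r in s..t, (σ - r) ^ (-q - 1) * (t - r) ^ (a : ℝ) := by
  rw [← intervalIntegral.integral_const_mul]
  refine intervalIntegral.norm_integral_le_of_norm_le hst (ae_of_all _ fun r hr => ?_)
    ((intervalIntegrable_sub_rpow_mul_sub_rpow hst htσ a.coe_nonneg).const_mul _)
  calc ‖G r • (x t - x r)‖ = |G r| * ‖x t - x r‖ := by rw [norm_smul, Real.norm_eq_abs]
    _ ≤ (D * (σ - r) ^ (-q - 1)) * (K * (t - r) ^ (a : ℝ)) :=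
      mul_le_mul (hG r ⟨hr.1.le, hr.2⟩) (norm_sub_le_of_holderWith hx hr.2) (norm_nonneg _)
        ((abs_nonneg _).trans (hG r ⟨hr.1.le, hr.2⟩))
    _ = D * K * ((σ - r) ^ (-q - 1) * (t - r) ^ (a : ℝ)) := by ring

lemma norm_smul_sub_add_integral_le_psi1 {A D : ℝ} {G : ℝ → ℝ} (hx : HolderWith K a x)
    (hst : s < t) (htσ : t < σ) (hT : t - s ≤ T) (hq : 0 < q) (hqa : q < a) (hαa : α ≤ a)
    (hA : |A| ≤ D * (σ - s) ^ (-q))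
    (hG : ∀ r ∈ Set.Icc s t, |G r| ≤ D * (σ - r) ^ (-q - 1)) :
    ‖A • (x t - x s) + ∫ r in s..t, G r • (x t - x r)‖ ≤
      D * (1 + 1 / q + 1 / (a - q)) * T ^ (a - α) * (K * psi1 α q σ t s) := by
  have hD : 0 ≤ D := nonneg_of_mul_nonneg_left ((abs_nonneg _).trans hA)
    (Real.rpow_pos_of_pos (by linarith) _)
  have hboundary : ‖A • (x t - x s)‖ ≤ D * K * ((σ - s) ^ (-q) * (t - s) ^ (a : ℝ)) := by
    calc ‖A • (x t - x s)‖ = |A| * ‖x t - x s‖ := by rw [norm_smul, Real.norm_eq_abs]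
      _ ≤ (D * (σ - s) ^ (-q)) * (K * (t - s) ^ (a : ℝ)) :=
        mul_le_mul hA (norm_sub_le_of_holderWith hx hst.le) (norm_nonneg _)
          ((abs_nonneg _).trans hA)
      _ = D * K * ((σ - s) ^ (-q) * (t - s) ^ (a : ℝ)) := by ring
  calc _ ≤ ‖A • (x t - x s)‖ + ‖∫ r in s..t, G r • (x t - x r)‖ := norm_add_le _ _
    _ ≤ D * K * (T ^ (a - α) * psi1 α q σ t s) +
        D * K * ((1 / q + 1 / (a - q)) * T ^ (a - α) * psi1 α q σ t s) := by
      refine add_le_add (hboundary.trans ?_)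
        ((norm_integral_smul_sub_le hx hst.le htσ hG).trans ?_)
      · exact mul_le_mul_of_nonneg_left (rpow_mul_rpow_le_psi1 hst htσ hT hq hαa)
          (mul_nonneg hD K.coe_nonneg)
      · gcongr
        exact integral_sub_rpow_mul_sub_rpow_le_psi1 hst htσ hT hq hqa hαa
    _ = _ := by ring

variable [CompleteSpace E]

lemma pathIntegral_eq (hx : Continuous x) (hst : s ≤ t) (htτ : t < τ) :
    pathIntegral γ x s t τ = (τ - s) ^ (-γ) • (x t - x s) +
      ∫ r in s..t, (γ * (τ - r) ^ (-γ - 1)) • (x t - x r) := by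
  have hsplit : ∫ r in s..t, (γ * (τ - r) ^ (-γ - 1)) • (x t - x r) =
      ((τ - t) ^ (-γ) - (τ - s) ^ (-γ)) • x t -
        ∫ r in s..t, (γ * (τ - r) ^ (-γ - 1)) • x r := by
    simp only [smul_sub]
    rw [intervalIntegral.integral_sub
      (intervalIntegrable_sub_rpow_smul continuous_const hst htτ)
      (intervalIntegrable_sub_rpow_smul hx hst htτ),
      intervalIntegral.integral_smul_const, integral_mul_sub_rpow hst htτ]
  rw [hsplit, pathIntegral]
  module

lemma pathIntegral_sub_pathIntegral (hx : Continuous x) (hst : s ≤ t) (htτ' : t < τ')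
    (hτ : τ' < τ) :
    pathIntegral γ x s t τ' - pathIntegral γ x s t τ =
      ((τ' - s) ^ (-γ) - (τ - s) ^ (-γ)) • (x t - x s) +
        ∫ r in s..t, (γ * ((τ' - r) ^ (-γ - 1) - (τ - r) ^ (-γ - 1))) • (x t - x r) := by
  have hcont : Continuous fun r => x t - x r := continuous_const.sub hx
  rw [pathIntegral_eq hx hst htτ', pathIntegral_eq hx hst (htτ'.trans hτ)]
  simp only [mul_sub, sub_smul]
  rw [intervalIntegral.integral_sub (intervalIntegrable_sub_rpow_smul hcont hst htτ')
    (intervalIntegrable_sub_rpow_smul hcont hst (htτ'.trans hτ))]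
  abel

lemma map_pathIntegral {F : Type*} [NormedAddCommGroup F] [NormedSpace ℝ F] [CompleteSpace F]
    (L : E →L[ℝ] F) (hx : Continuous x) (hst : s ≤ t) (htτ : t < τ) :
    L (pathIntegral γ x s t τ) = pathIntegral γ (fun r => L (x r)) s t τ := by
  simp only [pathIntegral, map_sub, map_smul,
    ← L.intervalIntegral_comp_comm (intervalIntegrable_sub_rpow_smul hx hst htτ)]

lemma norm_pathIntegral_le (hx : HolderWith K a x) (hst : s < t) (htτ : t < τ) (hT : t - s ≤ T)
    (hγ : 0 < γ) (hγa : γ < a) (hαa : α ≤ a) :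
    ‖pathIntegral γ x s t τ‖ ≤
      max 1 γ * (1 + 1 / γ + 1 / (a - γ)) * T ^ (a - α) * (K * psi1 α γ τ t s) := by
  rw [pathIntegral_eq (hx.continuous (by exact_mod_cast hγ.trans hγa)) hst.le htτ]
  refine norm_smul_sub_add_integral_le_psi1 hx hst htτ hT hγ hγa hαa ?_ fun r hr => ?_
  · have : 0 ≤ (τ - s) ^ (-γ) := Real.rpow_nonneg (by linarith) _
    rw [abs_of_nonneg this]
    exact le_mul_of_one_le_left this (le_max_left _ _)
  · have : 0 ≤ (τ - r) ^ (-γ - 1) := Real.rpow_nonneg (by linarith [hr.2]) _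
    rw [abs_of_nonneg (by positivity)]
    gcongr
    exact le_max_right _ _

lemma norm_pathIntegral_sub_pathIntegral_le (hx : HolderWith K a x) (hst : s < t)
    (htτ' : t < τ') (hτ : τ' < τ) (hT : t - s ≤ T) (hγ : 0 < γ) (hη : η ≤ 1)
    (hζ : 0 ≤ ζ) (hζη : ζ ≤ η) (hγζa : γ + ζ < a) (hαa : α ≤ a) :
    ‖pathIntegral γ x s t τ - pathIntegral γ x s t τ'‖ ≤
      (γ + 1) ^ 2 * (1 + 1 / (γ + ζ) + 1 / (a - (γ + ζ))) * T ^ (a - α) *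
        (K * psi12 α γ η ζ τ τ' t s) := by
  have ha : (0 : ℝ) < a := by linarith
  have hη01 : η ∈ Set.Icc (0 : ℝ) 1 := ⟨hζ.trans hζη, hη⟩
  set W := (τ - τ') ^ η * (τ' - t) ^ (-(η - ζ)) with hW
  rw [norm_sub_rev, pathIntegral_sub_pathIntegral (hx.continuous (by exact_mod_cast ha)) hst.le
    htτ' hτ, psi12_of_lt htτ' hτ, ← hW]
  refine (norm_smul_sub_add_integral_le_psi1 (D := (γ + 1) ^ 2 * W) hx hst htτ' hT
    (add_pos_of_pos_of_nonneg hγ hζ) hγζa hαa ?_ fun r hr => ?_).trans (le_of_eq (by ring))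
  · have hs0 : 0 ≤ τ' - s := by linarith
    refine (abs_sub_rpow_neg_sub_sub_rpow_neg_le hγ hη01 hζη hst.le htτ' hτ).trans ?_
    rw [← hW, neg_add']
    gcongr
    exact max_le (by nlinarith) (by nlinarith)
  · have hr0 : 0 ≤ τ' - r := by linarith [hr.2]
    have hexp : -(γ + ζ) - 1 = -(γ + 1) - ζ := by ring
    rw [abs_mul, abs_of_pos hγ, ← neg_add', hexp]
    calc γ * |(τ' - r) ^ (-(γ + 1)) - (τ - r) ^ (-(γ + 1))|
        ≤ γ * (max 1 (γ + 1) * W * (τ' - r) ^ (-(γ + 1) - ζ)) := by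
          gcongr
          exact abs_sub_rpow_neg_sub_sub_rpow_neg_le (by linarith) hη01 hζη hr.2 htτ' hτ
      _ = γ * (γ + 1) * W * (τ' - r) ^ (-(γ + 1) - ζ) := by
          rw [max_eq_right (by linarith)]; ring
      _ ≤ (γ + 1) ^ 2 * W * (τ' - r) ^ (-(γ + 1) - ζ) := by
          gcongr
          nlinarith

/-- The left-point Riemann sum of `∫ (τ-r)^{-γ} dx_r` over the first `n` intervals of the
subdivision `u 0 ≤ u 1 ≤ ⋯`. -/
noncomputable def riemannSum (γ : ℝ) (x : ℝ → E) (u : ℕ → ℝ) (τ : ℝ) (n : ℕ) : E :=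
  ∑ k ∈ Finset.range n, (τ - u k) ^ (-γ) • (x (u (k + 1)) - x (u k))

lemma norm_smul_sub_sub_pathIntegral_le (hx : HolderWith K a x) (ha : 0 < a) (hγ : 0 < γ)
    (hst : s ≤ t) (htτ : t < τ) :
    ‖(τ - s) ^ (-γ) • (x t - x s) - pathIntegral γ x s t τ‖ ≤
      K * (t - s) ^ (a : ℝ) * ((τ - t) ^ (-γ) - (τ - s) ^ (-γ)) := by
  rw [pathIntegral_eq (hx.continuous ha) hst htτ, sub_add_cancel_left, norm_neg,
    ← integral_mul_sub_rpow hst htτ, ← intervalIntegral.integral_const_mul]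
  refine intervalIntegral.norm_integral_le_of_norm_le hst (ae_of_all _ fun r hr => ?_)
    (continuousOn_const.mul (continuousOn_const.mul
      (continuousOn_sub_rpow hst htτ))).intervalIntegrable
  have hτr : 0 < τ - r := by linarith [hr.2]
  have htr : 0 ≤ t - r := sub_nonneg.2 hr.2
  rw [norm_smul, Real.norm_of_nonneg (by positivity), mul_comm]
  gcongr
  refine (norm_sub_le_of_holderWith hx hr.2).trans ?_
  gcongr
  exact hr.1.le

lemma norm_riemannSum_sub_pathIntegral_le {u : ℕ → ℝ} {δ : ℝ} {n : ℕ} (hx : HolderWith K a x)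
    (ha : 0 < a) (hγ : 0 < γ) (hu : Monotone u) (hδ : ∀ k, u (k + 1) - u k ≤ δ) (hn : u n < τ) :
    ‖riemannSum γ x u τ n - pathIntegral γ x (u 0) (u n) τ‖ ≤
      K * δ ^ (a : ℝ) * ((τ - u n) ^ (-γ) - (τ - u 0) ^ (-γ)) := by
  induction n with
  | zero => simp [riemannSum, pathIntegral]
  | succ n ih =>
    have hstep : u n ≤ u (n + 1) := hu n.le_succ
    have hmono : (τ - u n) ^ (-γ) ≤ (τ - u (n + 1)) ^ (-γ) :=
      Real.rpow_le_rpow_of_nonpos (by linarith) (by linarith) (by linarith)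
    have hlast : ‖(τ - u n) ^ (-γ) • (x (u (n + 1)) - x (u n)) -
        pathIntegral γ x (u n) (u (n + 1)) τ‖ ≤
        K * δ ^ (a : ℝ) * ((τ - u (n + 1)) ^ (-γ) - (τ - u n) ^ (-γ)) := by
      refine (norm_smul_sub_sub_pathIntegral_le hx ha hγ hstep hn).trans ?_
      gcongr
      exact hδ n
    rw [← pathIntegral_add_pathIntegral (hx.continuous ha) (hu n.zero_le) hstep hn, riemannSum,
      Finset.sum_range_succ, ← riemannSum, add_sub_add_comm]
    refine (norm_add_le_of_le (ih (hstep.trans_lt hn)) hlast).trans (le_of_eq (by ring))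

end Young

/-! ### Dyadic chaining and Kolmogorov's criterion -/

section Dyadic

open scoped NNReal

/-- The dyadic point `k / 2 ^ n` of the unit interval, truncated at `1`. -/
noncomputable def dyadicPoint (n k : ℕ) : unitInterval :=
  Set.projIcc 0 1 zero_le_one ((k : ℝ) / 2 ^ n)

/-- The index `k` of the dyadic interval `[k / 2 ^ n, (k + 1) / 2 ^ n)` that contains `t`. -/
noncomputable def dyadicIndex (n : ℕ) (t : unitInterval) : ℕ :=
  ⌊2 ^ n * (t : ℝ)⌋₊

lemma dyadicPoint_succ_two_mul (n k : ℕ) : dyadicPoint (n + 1) (2 * k) = dyadicPoint n k := by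
  rw [dyadicPoint, dyadicPoint, pow_succ', Nat.cast_mul, Nat.cast_two,
    mul_div_mul_left _ _ two_ne_zero]

lemma dyadicPoint_of_le {n k : ℕ} (h : 2 ^ n ≤ k) : dyadicPoint n k = 1 :=
  Set.projIcc_of_right_le _ ((one_le_div (by positivity)).2 (mod_cast h))

lemma dist_dyadicPoint_succ_le (n k : ℕ) :
    dist (dyadicPoint n k) (dyadicPoint n (k + 1)) ≤ (1 / 2) ^ n := by
  refine ((LipschitzWith.projIcc zero_le_one).dist_le_mul _ _).trans (le_of_eq ?_)
  rw [NNReal.coe_one, one_mul, Real.dist_eq, abs_sub_comm, ← sub_div, Nat.cast_succ,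
    add_sub_cancel_left, abs_of_pos (by positivity), one_div_pow]

lemma dist_dyadicPoint_dyadicIndex_le (n : ℕ) (t : unitInterval) :
    dist (dyadicPoint n (dyadicIndex n t)) t ≤ (1 / 2) ^ n := by
  have hn : (0 : ℝ) < 2 ^ n := by positivity
  have hle : (dyadicIndex n t : ℝ) ≤ 2 ^ n * t := Nat.floor_le (mul_nonneg hn.le t.2.1)
  have hlt : 2 ^ n * (t : ℝ) < dyadicIndex n t + 1 := Nat.lt_floor_add_one _
  calc dist (dyadicPoint n (dyadicIndex n t)) t
      = dist (dyadicPoint n (dyadicIndex n t)) (Set.projIcc 0 1 zero_le_one (t : ℝ)) := by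
        rw [Set.projIcc_val]
    _ ≤ |(dyadicIndex n t : ℝ) / 2 ^ n - t| := by
        simpa only [dyadicPoint, NNReal.coe_one, one_mul, Real.dist_eq] using
          (LipschitzWith.projIcc zero_le_one).dist_le_mul ((dyadicIndex n t : ℝ) / 2 ^ n) (t : ℝ)
    _ ≤ (1 / 2) ^ n := by
        rw [abs_sub_comm, one_div_pow, abs_of_nonneg, sub_le_iff_le_add, ← add_div,
          le_div_iff₀ hn]
        · linarith
        · rw [sub_nonneg, div_le_iff₀ hn]
          linarith

lemma dyadicIndex_succ (n : ℕ) (t : unitInterval) :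
    dyadicIndex (n + 1) t = 2 * dyadicIndex n t ∨
      dyadicIndex (n + 1) t = 2 * dyadicIndex n t + 1 := by
  have hdouble : (2 : ℝ) ^ (n + 1) * t = 2 * (2 ^ n * t) := by ring
  have hnonneg : (0 : ℝ) ≤ 2 ^ n * t := mul_nonneg (by positivity) t.2.1
  have hle : (dyadicIndex n t : ℝ) ≤ 2 ^ n * t := Nat.floor_le hnonneg
  have hlt : 2 ^ n * (t : ℝ) < dyadicIndex n t + 1 := Nat.lt_floor_add_one _
  have hlower : 2 * dyadicIndex n t ≤ dyadicIndex (n + 1) t := by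
    refine Nat.le_floor ?_
    rw [hdouble]
    push_cast
    linarith
  have hupper : dyadicIndex (n + 1) t < 2 * dyadicIndex n t + 2 := by
    refine (Nat.floor_lt (by rw [hdouble]; positivity)).2 ?_
    rw [hdouble]
    push_cast
    linarith
  omega

lemma dyadicIndex_eq_or_eq_succ {n : ℕ} {s t : unitInterval} (hst : s ≤ t)
    (h : dist s t ≤ (1 / 2) ^ n) :
    dyadicIndex n t = dyadicIndex n s ∨ dyadicIndex n t = dyadicIndex n s + 1 := by
  have hn : (0 : ℝ) < 2 ^ n := by positivity
  have hst' : (s : ℝ) ≤ t := hst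
  have hlower : dyadicIndex n s ≤ dyadicIndex n t := Nat.floor_le_floor (by gcongr)
  have hupper : dyadicIndex n t ≤ dyadicIndex n s + 1 := by
    rw [dyadicIndex, dyadicIndex, ← Nat.floor_add_one (mul_nonneg hn.le s.2.1)]
    refine Nat.floor_le_floor ?_
    rw [Subtype.dist_eq, dist_comm, Real.dist_eq, abs_of_nonneg (sub_nonneg.2 hst'), one_div_pow,
      le_div_iff₀ hn] at h
    linarith
  omega

section Deterministic

variable {E : Type*} [PseudoMetricSpace E] {f g : unitInterval → E} {S ρ : ℝ} {a : ℝ≥0}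

/-- The dyadic approximation of level `n` of a function, constant on the dyadic intervals. -/
noncomputable def dyadicApprox (f : unitInterval → E) (n : ℕ) (t : unitInterval) : E :=
  f (dyadicPoint n (dyadicIndex n t))

lemma dist_dyadicApprox_succ_le (hρ1 : ρ ≤ 1)
    (hf : ∀ n k, dist (f (dyadicPoint n k)) (f (dyadicPoint n (k + 1))) ≤ S * ρ ^ n)
    (hS : 0 ≤ S) (hρ : 0 ≤ ρ) (t : unitInterval) (n : ℕ) :
    dist (dyadicApprox f n t) (dyadicApprox f (n + 1) t) ≤ S * ρ ^ n := by
  rw [dyadicApprox, dyadicApprox, ← dyadicPoint_succ_two_mul n]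
  rcases dyadicIndex_succ n t with h | h
  · rw [h, dist_self]
    positivity
  · rw [h]
    exact (hf (n + 1) _).trans
      (mul_le_mul_of_nonneg_left (pow_le_pow_of_le_one hρ hρ1 n.le_succ) hS)

lemma dist_dyadicApprox_le {n : ℕ}
    (hf : ∀ k, dist (f (dyadicPoint n k)) (f (dyadicPoint n (k + 1))) ≤ S) {s t : unitInterval}
    (hst : dist s t ≤ (1 / 2) ^ n) : dist (dyadicApprox f n s) (dyadicApprox f n t) ≤ S := by
  wlog hle : s ≤ t generalizing s t
  · rw [dist_comm]
    exact this (by rwa [dist_comm]) (le_of_not_ge hle)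
  unfold dyadicApprox
  rcases dyadicIndex_eq_or_eq_succ hle hst with h | h
  · rw [h, dist_self]
    exact dist_nonneg.trans (hf 0)
  · rw [h]
    exact hf _

lemma holderWith_of_dist_le {X Y : Type*} [PseudoMetricSpace X] [PseudoMetricSpace Y] {f : X → Y}
    {C a : ℝ≥0} (h : ∀ x y, dist (f x) (f y) ≤ C * dist x y ^ (a : ℝ)) : HolderWith C a f := by
  intro x y
  rw [edist_dist, edist_dist, ENNReal.ofReal_rpow_of_nonneg dist_nonneg NNReal.zero_le_coe,
    ← ENNReal.ofReal_coe_nnreal, ← ENNReal.ofReal_mul NNReal.zero_le_coe]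
  exact ENNReal.ofReal_le_ofReal (h x y)

lemma half_rpow_lt_one {a : ℝ} (ha : 0 < a) : (1 / 2 : ℝ) ^ a < 1 :=
  Real.rpow_lt_one (by norm_num) (by norm_num) ha

/-- The factor lost when a Hölder bound of exponent `a` on the dyadic increments of a function is
turned into a Hölder bound on the function: the chains joining two points to the scale of their
distance contribute a geometric series each. -/
noncomputable def chainingConst (a : ℝ≥0) : ℝ≥0 :=
  (2 ^ (a : ℝ) * (1 + 2 / (1 - (1 / 2) ^ (a : ℝ))) : ℝ).toNNReal

lemma dist_le_of_tendsto_dyadicApprox (hρ : 0 < ρ) (hρ1 : ρ < 1) (hS : 0 ≤ S)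
    (hf : ∀ n k, dist (f (dyadicPoint n k)) (f (dyadicPoint n (k + 1))) ≤ S * ρ ^ n)
    (hg : ∀ t, Tendsto (fun n => dyadicApprox f n t) atTop (𝓝 (g t))) {n : ℕ}
    {s t : unitInterval} (hst : dist s t ≤ (1 / 2) ^ n) :
    dist (g s) (g t) ≤ (1 + 2 / (1 - ρ)) * (S * ρ ^ n) := by
  have hchain : ∀ t, dist (dyadicApprox f n t) (g t) ≤ S * ρ ^ n / (1 - ρ) := fun t =>
    dist_le_of_le_geometric_of_tendsto ρ S hρ1
      (dist_dyadicApprox_succ_le hρ1.le hf hS hρ.le t) (hg t) n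
  calc dist (g s) (g t)
      ≤ dist (g s) (dyadicApprox f n s) + dist (dyadicApprox f n s) (dyadicApprox f n t) +
          dist (dyadicApprox f n t) (g t) := dist_triangle4 _ _ _ _
    _ ≤ S * ρ ^ n / (1 - ρ) + S * ρ ^ n + S * ρ ^ n / (1 - ρ) := by
        gcongr
        exacts [(dist_comm _ _).trans_le (hchain s), dist_dyadicApprox_le (hf n) hst, hchain t]
    _ = (1 + 2 / (1 - ρ)) * (S * ρ ^ n) := by ring

lemma holderWith_of_tendsto_dyadicApprox (ha : 0 < a) {S : ℝ≥0}
    (hf : ∀ n k, dist (f (dyadicPoint n k)) (f (dyadicPoint n (k + 1))) ≤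
      S * ((1 / 2) ^ (a : ℝ)) ^ n)
    (hg : ∀ t, Tendsto (fun n => dyadicApprox f n t) atTop (𝓝 (g t))) :
    HolderWith (chainingConst a * S) a g := by
  have hρ1 := half_rpow_lt_one (NNReal.coe_pos.2 ha)
  refine holderWith_of_dist_le fun s t => ?_
  rw [NNReal.coe_mul, chainingConst, Real.coe_toNNReal _ (by positivity)]
  rcases eq_or_ne s t with rfl | hne
  · rw [dist_self, dist_self]
    positivity
  obtain ⟨n, hlt, hle⟩ := exists_nat_pow_near_of_lt_one (dist_pos.2 hne)
    (Real.dist_le_of_mem_Icc_01 s.2 t.2) (y := (1 / 2 : ℝ)) (by norm_num) (by norm_num)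
  have hpow : ((1 / 2 : ℝ) ^ (a : ℝ)) ^ n ≤ 2 ^ (a : ℝ) * dist s t ^ (a : ℝ) := by
    rw [← Real.rpow_natCast, ← Real.rpow_mul (by norm_num), mul_comm (a : ℝ),
      Real.rpow_mul (by norm_num), Real.rpow_natCast, ← Real.mul_rpow two_pos.le dist_nonneg]
    gcongr
    rw [pow_succ] at hlt
    linarith
  calc dist (g s) (g t)
      ≤ (1 + 2 / (1 - (1 / 2) ^ (a : ℝ))) * (S * ((1 / 2) ^ (a : ℝ)) ^ n) :=
        dist_le_of_tendsto_dyadicApprox (by positivity) hρ1 S.2 hf hg hle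
    _ ≤ (1 + 2 / (1 - (1 / 2) ^ (a : ℝ))) * (S * (2 ^ (a : ℝ) * dist s t ^ (a : ℝ))) := by gcongr
    _ = _ := by ring

/-- The Hölder seminorm of exponent `a` restricted to neighbouring dyadic points. -/
noncomputable def dyadicSeminorm (a : ℝ) (f : unitInterval → E) : ℝ≥0∞ :=
  ⨆ n : ℕ, ⨆ k ∈ Finset.range (2 ^ n),
    2 ^ (a * n) * edist (f (dyadicPoint n k)) (f (dyadicPoint n (k + 1)))

lemma dist_dyadicPoint_le_dyadicSeminorm {a : ℝ} (hf : dyadicSeminorm a f ≠ ∞) (n k : ℕ) :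
    dist (f (dyadicPoint n k)) (f (dyadicPoint n (k + 1))) ≤
      (dyadicSeminorm a f).toNNReal * ((1 / 2) ^ a) ^ n := by
  rcases lt_or_ge k (2 ^ n) with hk | hk
  · have hle : 2 ^ (a * n) * edist (f (dyadicPoint n k)) (f (dyadicPoint n (k + 1))) ≤
        dyadicSeminorm a f :=
      le_iSup_of_le n (le_iSup₂_of_le k (Finset.mem_range.2 hk) le_rfl)
    have hreal := ENNReal.toReal_mono hf hle
    rw [ENNReal.toReal_mul, edist_dist, ENNReal.toReal_ofReal dist_nonneg, ← ENNReal.toReal_rpow,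
      ENNReal.toReal_ofNat] at hreal
    rw [← Real.rpow_natCast, ← Real.rpow_mul (by norm_num), one_div,
      Real.inv_rpow two_pos.le, ← div_eq_mul_inv, le_div_iff₀ (by positivity), mul_comm]
    exact hreal
  · rw [dyadicPoint_of_le hk, dyadicPoint_of_le (hk.trans k.le_succ), dist_self]
    positivity

lemma exists_tendsto_dyadicApprox [CompleteSpace E] {a : ℝ} (ha : 0 < a)
    (hf : dyadicSeminorm a f ≠ ∞) (t : unitInterval) :
    ∃ y, Tendsto (fun n => dyadicApprox f n t) atTop (𝓝 y) :=
  cauchySeq_tendsto_of_complete <| cauchySeq_of_le_geometric _ _ (half_rpow_lt_one ha) <|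
    dist_dyadicApprox_succ_le (half_rpow_lt_one ha).le (dist_dyadicPoint_le_dyadicSeminorm hf)
      NNReal.zero_le_coe (by positivity) t

lemma exists_holderWith_of_dyadicSeminorm [CompleteSpace E] (ha : 0 < a) (f : unitInterval → E) :
    ∃ g, HolderWith (chainingConst a * (dyadicSeminorm a f).toNNReal) a g ∧
      (dyadicSeminorm a f ≠ ∞ → ∀ t, Tendsto (fun n => dyadicApprox f n t) atTop (𝓝 (g t))) := by
  by_cases hf : dyadicSeminorm a f = ∞
  · exact ⟨fun _ => f 0, HolderWith.const.mono zero_le, fun h => absurd hf h⟩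
  choose g hg using exists_tendsto_dyadicApprox (NNReal.coe_pos.2 ha) hf
  exact ⟨g, holderWith_of_tendsto_dyadicApprox ha (dist_dyadicPoint_le_dyadicSeminorm hf) hg,
    fun _ => hg⟩

lemma dyadicSeminorm_rpow_le (a : ℝ) (f : unitInterval → E) {p : ℝ} (hp : 0 < p) :
    dyadicSeminorm a f ^ p ≤ ∑' n : ℕ, ∑ k ∈ Finset.range (2 ^ n),
      (2 ^ (a * n) * edist (f (dyadicPoint n k)) (f (dyadicPoint n (k + 1)))) ^ p := by
  rw [← ENNReal.le_rpow_inv_iff hp]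
  refine iSup_le fun n => iSup₂_le fun k hk => ?_
  rw [ENNReal.le_rpow_inv_iff hp]
  exact (Finset.single_le_sum (f := fun k =>
    (2 ^ (a * n) * edist (f (dyadicPoint n k)) (f (dyadicPoint n (k + 1)))) ^ p)
      (fun _ _ => zero_le) hk).trans (ENNReal.le_tsum n)

end Deterministic

section Random

variable {Ω E : Type*} [MeasurableSpace Ω] {P : Measure Ω}

lemma lintegral_rpow_lt_top_of_le [IsFiniteMeasure P] {f : Ω → ℝ≥0∞} {p q : ℝ} (hq : 0 ≤ q)
    (hqp : q ≤ p) (hf : ∫⁻ ω, f ω ^ p ∂P < ∞) : ∫⁻ ω, f ω ^ q ∂P < ∞ :=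
  calc ∫⁻ ω, f ω ^ q ∂P ≤ ∫⁻ ω, 1 + f ω ^ p ∂P := by
        refine lintegral_mono fun ω => ?_
        rcases le_total (f ω) 1 with h | h
        · exact (ENNReal.rpow_le_one h hq).trans le_self_add
        · exact (ENNReal.rpow_le_rpow_of_exponent_le h hqp).trans le_add_self
    _ = P Set.univ + ∫⁻ ω, f ω ^ p ∂P := by rw [lintegral_add_left measurable_const, lintegral_one]
    _ < ∞ := ENNReal.add_lt_top.2 ⟨measure_lt_top _ _, hf⟩

section PseudoMetric

variable [PseudoMetricSpace E] {X : unitInterval → Ω → E} {p q : ℝ} {M : ℝ≥0}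

lemma aemeasurable_dyadicSeminorm (hX : IsAEKolmogorovProcess X P p q M) (a : ℝ) :
    AEMeasurable (fun ω => dyadicSeminorm a fun t => X t ω) P :=
  AEMeasurable.iSup fun n => AEMeasurable.biSup _ (Finset.range (2 ^ n)).countable_toSet
    fun _ _ => hX.aemeasurable_edist.const_mul _

lemma lintegral_edist_rpow_le (hX : IsAEKolmogorovProcess X P p q M) {s t : unitInterval} {n : ℕ}
    (hst : dist s t ≤ (1 / 2) ^ n) : ∫⁻ ω, edist (X s ω) (X t ω) ^ p ∂P ≤ M * (2 ^ (-q)) ^ n := by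
  refine (hX.kolmogorovCondition s t).trans ?_
  have hedist : edist s t ≤ 2 ^ (-(n : ℝ)) := by
    refine ((edist_le_ofReal (by positivity)).2 hst).trans_eq ?_
    rw [ENNReal.ofReal_pow (by norm_num), ENNReal.ofReal_div_of_pos two_pos, ENNReal.ofReal_one,
      ENNReal.ofReal_ofNat, one_div, ENNReal.rpow_neg, ENNReal.rpow_natCast, ENNReal.inv_pow]
  calc (M : ℝ≥0∞) * edist s t ^ q ≤ M * (2 ^ (-(n : ℝ))) ^ q := by
        gcongr
        exact hX.q_pos.le
    _ = M * (2 ^ (-q)) ^ n := by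
        rw [← ENNReal.rpow_natCast, ← ENNReal.rpow_mul, ← ENNReal.rpow_mul, neg_mul_comm,
          mul_comm (n : ℝ)]

lemma sum_lintegral_dyadicIncrement_rpow_le (hX : IsAEKolmogorovProcess X P p q M) (a : ℝ)
    (n : ℕ) : ∑ k ∈ Finset.range (2 ^ n), ∫⁻ ω, (2 ^ (a * n) *
      edist (X (dyadicPoint n k) ω) (X (dyadicPoint n (k + 1)) ω)) ^ p ∂P ≤
      M * (2 ^ (1 + a * p - q)) ^ n := by
  have hterm : ∀ k, ∫⁻ ω, (2 ^ (a * n) *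
      edist (X (dyadicPoint n k) ω) (X (dyadicPoint n (k + 1)) ω)) ^ p ∂P ≤
        (2 ^ (a * n)) ^ p * (M * (2 ^ (-q)) ^ n) := by
    intro k
    simp only [ENNReal.mul_rpow_of_nonneg _ _ hX.p_pos.le]
    rw [lintegral_const_mul'' _ (hX.aemeasurable_edist.pow_const p)]
    gcongr
    exact lintegral_edist_rpow_le hX (dist_dyadicPoint_succ_le n k)
  refine (Finset.sum_le_sum fun k _ => hterm k).trans (le_of_eq ?_)
  rw [Finset.sum_const, Finset.card_range, nsmul_eq_mul, Nat.cast_pow, Nat.cast_two, sub_eq_add_neg,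
    ENNReal.rpow_add _ _ two_ne_zero ENNReal.ofNat_ne_top,
    ENNReal.rpow_add _ _ two_ne_zero ENNReal.ofNat_ne_top, ENNReal.rpow_one, mul_pow, mul_pow,
    ← ENNReal.rpow_mul, mul_right_comm a, ENNReal.rpow_mul_natCast (2 : ℝ≥0∞) (a * p) n]
  ring

lemma lintegral_dyadicSeminorm_rpow_lt_top (hX : IsAEKolmogorovProcess X P p q M) {a : ℝ}
    (hq : 1 + a * p < q) : ∫⁻ ω, (dyadicSeminorm a fun t => X t ω) ^ p ∂P < ∞ := by
  have hmeas : ∀ n k : ℕ, AEMeasurable (fun ω => (2 ^ (a * n) *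
      edist (X (dyadicPoint n k) ω) (X (dyadicPoint n (k + 1)) ω)) ^ p) P := fun n k =>
    (hX.aemeasurable_edist.const_mul _).pow_const p
  have hratio : (2 : ℝ≥0∞) ^ (1 + a * p - q) < 1 :=
    ENNReal.rpow_lt_one_of_one_lt_of_neg ENNReal.one_lt_two (by linarith)
  calc ∫⁻ ω, (dyadicSeminorm a fun t => X t ω) ^ p ∂P
      ≤ ∫⁻ ω, ∑' n : ℕ, ∑ k ∈ Finset.range (2 ^ n), (2 ^ (a * n) *
          edist (X (dyadicPoint n k) ω) (X (dyadicPoint n (k + 1)) ω)) ^ p ∂P :=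
        lintegral_mono fun ω => dyadicSeminorm_rpow_le a _ hX.p_pos
    _ = ∑' n : ℕ, ∑ k ∈ Finset.range (2 ^ n), ∫⁻ ω, (2 ^ (a * n) *
          edist (X (dyadicPoint n k) ω) (X (dyadicPoint n (k + 1)) ω)) ^ p ∂P := by
        rw [lintegral_tsum fun n => Finset.aemeasurable_fun_sum _ fun k _ => hmeas n k]
        exact tsum_congr fun n => lintegral_finsetSum' _ fun k _ => hmeas n k
    _ ≤ ∑' n : ℕ, (M : ℝ≥0∞) * (2 ^ (1 + a * p - q)) ^ n :=
        ENNReal.tsum_le_tsum (sum_lintegral_dyadicIncrement_rpow_le hX a)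
    _ < ∞ := by
        rw [ENNReal.tsum_mul_left, ENNReal.tsum_geometric]
        exact ENNReal.mul_lt_top ENNReal.coe_lt_top (ENNReal.inv_lt_top.2 (tsub_pos_of_lt hratio))

lemma ae_tendsto_dyadicApprox (hX : IsAEKolmogorovProcess X P p q M) (t : unitInterval) :
    ∀ᵐ ω ∂P, Tendsto (fun n => dyadicApprox (fun s => X s ω) n t) atTop (𝓝 (X t ω)) := by
  have hmeas : ∀ n, AEMeasurable
      (fun ω => edist (dyadicApprox (fun s => X s ω) n t) (X t ω) ^ p) P := fun n =>
    hX.aemeasurable_edist.pow_const p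
  have hratio : (2 : ℝ≥0∞) ^ (-q) < 1 :=
    ENNReal.rpow_lt_one_of_one_lt_of_neg ENNReal.one_lt_two (neg_lt_zero.2 hX.q_pos)
  have hsum : ∫⁻ ω, ∑' n, edist (dyadicApprox (fun s => X s ω) n t) (X t ω) ^ p ∂P < ∞ := by
    rw [lintegral_tsum hmeas]
    refine (ENNReal.tsum_le_tsum fun n =>
      lintegral_edist_rpow_le hX (dist_dyadicPoint_dyadicIndex_le n t)).trans_lt ?_
    rw [ENNReal.tsum_mul_left, ENNReal.tsum_geometric]
    exact ENNReal.mul_lt_top ENNReal.coe_lt_top (ENNReal.inv_lt_top.2 (tsub_pos_of_lt hratio))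
  filter_upwards [ae_lt_top' (AEMeasurable.tsum hmeas) hsum.ne] with ω hω
  have hlim := (ENNReal.tendsto_atTop_zero_of_tsum_ne_top hω.ne).ennrpow_const p⁻¹
  rw [tendsto_iff_edist_tendsto_0]
  simpa only [ENNReal.rpow_rpow_inv hX.p_pos.ne', ENNReal.zero_rpow_of_pos (inv_pos.2 hX.p_pos)]
    using hlim

end PseudoMetric

theorem exists_holderWith_modification [MetricSpace E] [CompleteSpace E] [IsFiniteMeasure P]
    {X : unitInterval → Ω → E} {h : ℝ} {a : ℝ≥0} (ha : 0 < a) (hah : a < h)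
    (hX : ∀ p, 1 ≤ p → ∃ M, IsAEKolmogorovProcess X P p (h * p) M) :
    ∃ (Y : Ω → unitInterval → E) (K : Ω → ℝ≥0), (∀ ω, HolderWith (K ω) a (Y ω)) ∧
      (∀ t, ∀ᵐ ω ∂P, Y ω t = X t ω) ∧ AEMeasurable K P ∧
      ∀ q : ℝ, 0 ≤ q → ∫⁻ ω, (K ω : ℝ≥0∞) ^ q ∂P < ∞ := by
  set S : Ω → ℝ≥0∞ := fun ω => dyadicSeminorm a fun t => X t ω
  obtain ⟨M, hXM⟩ := hX 1 le_rfl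
  have hSmeas : AEMeasurable S P := aemeasurable_dyadicSeminorm hXM a
  have hSmoment : ∀ q : ℝ, 0 ≤ q → ∫⁻ ω, S ω ^ q ∂P < ∞ := fun q hq => by
    have hgap : 0 < h - a := sub_pos.2 hah
    obtain ⟨p, hp⟩ := exists_gt (max (max q 1) (1 / (h - a)))
    simp only [max_lt_iff] at hp
    obtain ⟨⟨hqp, h1p⟩, hgap_p⟩ := hp
    obtain ⟨M, hXM⟩ := hX p h1p.le
    refine lintegral_rpow_lt_top_of_le hq hqp.le (lintegral_dyadicSeminorm_rpow_lt_top hXM ?_)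
    rw [div_lt_iff₀ hgap] at hgap_p
    linarith
  have hSfin : ∀ᵐ ω ∂P, S ω ≠ ∞ := by
    have := hSmoment 1 zero_le_one
    simp only [ENNReal.rpow_one] at this
    exact (ae_lt_top' hSmeas this.ne).mono fun ω hω => hω.ne
  choose Y hY hYlim using fun ω => exists_holderWith_of_dyadicSeminorm ha fun t => X t ω
  refine ⟨Y, fun ω => chainingConst a * (S ω).toNNReal, hY, fun t => ?_,
    hSmeas.ennreal_toNNReal.const_mul _, fun q hq => ?_⟩
  · filter_upwards [hSfin, ae_tendsto_dyadicApprox hXM t] with ω hω hlim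
    exact tendsto_nhds_unique (hYlim ω hω t) hlim
  · calc ∫⁻ ω, ((chainingConst a * (S ω).toNNReal : ℝ≥0) : ℝ≥0∞) ^ q ∂P
        ≤ ∫⁻ ω, (chainingConst a : ℝ≥0∞) ^ q * S ω ^ q ∂P := by
          refine lintegral_mono fun ω => ?_
          rw [← ENNReal.mul_rpow_of_nonneg _ _ hq, ENNReal.coe_mul]
          gcongr
          exact ENNReal.coe_toNNReal_le_self
      _ < ∞ := by
          rw [lintegral_const_mul'' _ (hSmeas.pow_const q)]
          exact ENNReal.mul_lt_top (ENNReal.rpow_lt_top_of_nonneg hq ENNReal.coe_ne_top)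
            (hSmoment q hq)

lemma isAEKolmogorovProcess_comp_of_lipschitzWith {ι κ : Type*} [PseudoEMetricSpace ι]
    [PseudoEMetricSpace κ] [PseudoEMetricSpace E] {X : κ → Ω → E} {p q : ℝ} {M L : ℝ≥0}
    (hX : IsAEKolmogorovProcess X P p q M) {φ : ι → κ} (hφ : LipschitzWith L φ) :
    IsAEKolmogorovProcess (fun i => X (φ i)) P p q (M * L ^ q) := by
  obtain ⟨Y, hY, hXY⟩ := hX
  refine ⟨fun i => Y (φ i), ⟨fun i j => hY.measurablePair _ _, fun i j => ?_, hY.p_pos, hY.q_pos⟩,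
    fun i => hXY (φ i)⟩
  calc ∫⁻ ω, edist (Y (φ i) ω) (Y (φ j) ω) ^ p ∂P ≤ M * edist (φ i) (φ j) ^ q :=
        hY.kolmogorovCondition _ _
    _ ≤ M * (L * edist i j) ^ q := by
        gcongr
        exacts [hY.q_pos.le, hφ i j]
    _ = (M * L ^ q : ℝ≥0) * edist i j ^ q := by
        rw [ENNReal.mul_rpow_of_nonneg _ _ hY.q_pos.le, ENNReal.coe_mul,
          ENNReal.coe_rpow_of_nonneg _ hY.q_pos.le, mul_assoc]

theorem exists_holderWith_modification_Icc [MetricSpace E] [CompleteSpace E] [IsFiniteMeasure P]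
    {T : ℝ} (hT : 0 < T) {X : Set.Icc 0 T → Ω → E} {h : ℝ} {a : ℝ≥0} (ha : 0 < a) (hah : a < h)
    (hX : ∀ p, 1 ≤ p → ∃ M, IsAEKolmogorovProcess X P p (h * p) M) :
    ∃ (Y : Ω → ℝ → E) (K : Ω → ℝ≥0), (∀ ω, HolderWith (K ω) a (Y ω)) ∧
      (∀ t : Set.Icc 0 T, ∀ᵐ ω ∂P, Y ω t = X t ω) ∧ AEMeasurable K P ∧
      ∀ q : ℝ, 0 ≤ q → ∫⁻ ω, (K ω : ℝ≥0∞) ^ q ∂P < ∞ := by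
  let scale (u : unitInterval) : Set.Icc 0 T := Set.projIcc 0 T hT.le (T * u)
  let unscale (r : ℝ) : unitInterval := Set.projIcc 0 1 zero_le_one (T⁻¹ * r)
  have hscale : LipschitzWith (1 * (‖T‖₊ * 1)) scale :=
    (LipschitzWith.projIcc hT.le).comp ((lipschitzWith_smul T).comp (LipschitzWith.subtype_val _))
  have hunscale : LipschitzWith (1 * ‖T⁻¹‖₊) unscale :=
    (LipschitzWith.projIcc zero_le_one).comp (lipschitzWith_smul T⁻¹)
  have hinv : ∀ t : Set.Icc 0 T, scale (unscale t) = t := fun t => by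
    have ht : T⁻¹ * (t : ℝ) ∈ Set.Icc 0 1 :=
      ⟨mul_nonneg (inv_nonneg.2 hT.le) t.2.1, (inv_mul_le_one₀ hT).2 t.2.2⟩
    simp only [scale, unscale, Set.projIcc_of_mem _ ht, mul_inv_cancel_left₀ hT.ne',
      Set.projIcc_val]
  obtain ⟨Y, K, hY, hYX, hK, hmoment⟩ :=
    exists_holderWith_modification (X := fun u => X (scale u)) ha hah fun p hp =>
      (hX p hp).imp' _ fun M hM => isAEKolmogorovProcess_comp_of_lipschitzWith hM hscale
  set c : ℝ≥0 := (1 * ‖T⁻¹‖₊) ^ (a : ℝ)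
  refine ⟨fun ω r => Y ω (unscale r), fun ω => K ω * c, fun ω => ?_, fun t => ?_,
    hK.mul_const c, fun q hq => ?_⟩
  · have hcomp := (hY ω).comp hunscale.holderWith
    rwa [mul_one] at hcomp
  · filter_upwards [hYX (unscale t)] with ω hω
    rw [hω, hinv]
  · simp only [ENNReal.coe_mul, ENNReal.mul_rpow_of_nonneg _ _ hq]
    rw [lintegral_mul_const'' _ (hK.coe_nnreal_ennreal.pow_const q)]
    exact ENNReal.mul_lt_top (hmoment q hq) (ENNReal.rpow_lt_top_of_nonneg hq ENNReal.coe_ne_top)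

end Random

end Dyadic

/-! ### Moments of fractional Brownian motion -/

section Moments

open scoped NNReal

variable {Ω : Type*} [MeasurableSpace Ω] {P : Measure Ω} {H T : ℝ} {m : ℕ}
  {B : Set.Icc (0 : ℝ) T → Ω → EuclideanSpace ℝ (Fin m)}

lemma lintegral_enorm_rpow_gaussianReal_lt_top (μ : ℝ) (v : ℝ≥0) {p : ℝ} (hp : 0 < p) :
    ∫⁻ y, ‖y‖ₑ ^ p ∂(gaussianReal μ v) < ∞ := by
  have hfin := lintegral_rpow_enorm_lt_top_of_eLpNorm_lt_top
    (ENNReal.ofReal_pos.2 hp).ne' ENNReal.ofReal_ne_top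
    (memLp_id_gaussianReal' (μ := μ) (v := v) (ENNReal.ofReal p)
      ENNReal.ofReal_ne_top).eLpNorm_lt_top
  rwa [ENNReal.toReal_ofReal hp.le] at hfin

lemma enorm_rpow_le_mul_sum_enorm_rpow (x : EuclideanSpace ℝ (Fin m)) {p : ℝ} (hp : 1 ≤ p) :
    ‖x‖ₑ ^ p ≤ (m : ℝ≥0∞) ^ (p - 1) * ∑ i, ‖x i‖ₑ ^ p := by
  have hsum : ‖x‖ₑ ≤ ∑ i, ‖x i‖ₑ :=
    calc ‖x‖ₑ = ‖∑ i, x i • EuclideanSpace.basisFun (Fin m) ℝ i‖ₑ := by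
          conv_lhs => rw [← (EuclideanSpace.basisFun (Fin m) ℝ).sum_repr x]
          simp only [EuclideanSpace.basisFun_repr]
      _ ≤ ∑ i, ‖x i • EuclideanSpace.basisFun (Fin m) ℝ i‖ₑ := enorm_sum_le _ _
      _ = ∑ i, ‖x i‖ₑ := by
          simp only [enorm_smul, OrthonormalBasis.enorm_eq_one, mul_one]
  calc ‖x‖ₑ ^ p ≤ (∑ i, ‖x i‖ₑ) ^ p := by gcongr
    _ ≤ (m : ℝ≥0∞) ^ (p - 1) * ∑ i, ‖x i‖ₑ ^ p := by
        simpa only [Finset.card_univ, Fintype.card_fin] using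
          ENNReal.rpow_sum_le_const_mul_sum_rpow Finset.univ (fun i => ‖x i‖ₑ) hp

lemma IsFBM.isGaussianProcess_coord (hB : IsFBM P H T B) (i : Fin m) :
    IsGaussianProcess (fun t ω => B t ω i) P :=
  hB.gaussian.comp_left fun _ => EuclideanSpace.proj i

lemma IsFBM.memLp_coord (hB : IsFBM P H T B) (i : Fin m) (t : Set.Icc (0 : ℝ) T) :
    MemLp (fun ω => B t ω i) 2 P :=
  ((hB.isGaussianProcess_coord i).hasGaussianLaw_eval t).memLp_two

variable [IsProbabilityMeasure P]

lemma IsFBM.integral_mul (hB : IsFBM P H T B) (i : Fin m) (s t : Set.Icc (0 : ℝ) T) :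
    ∫ ω, B s ω i * B t ω i ∂P =
      (|(t : ℝ)| ^ (2 * H) + |(s : ℝ)| ^ (2 * H) - |(t : ℝ) - (s : ℝ)| ^ (2 * H)) / 2 := by
  rw [← hB.covariance s t i, covariance_eq_sub (hB.memLp_coord i s) (hB.memLp_coord i t),
    hB.centered, hB.centered, zero_mul, sub_zero]
  rfl

lemma IsFBM.variance_sub (hB : IsFBM P H T B) (hH : 0 < H) (i : Fin m)
    (s t : Set.Icc (0 : ℝ) T) :
    Var[fun ω => B s ω i - B t ω i; P] = (|(s : ℝ) - t| ^ H) ^ 2 := by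
  have hs := hB.memLp_coord i s
  have ht := hB.memLp_coord i t
  rw [variance_fun_sub hs ht, ← covariance_self hs.aemeasurable,
    ← covariance_self ht.aemeasurable, hB.covariance, hB.covariance, hB.covariance, sub_self,
    sub_self, abs_zero, Real.zero_rpow (by positivity), ← Real.rpow_natCast,
    ← Real.rpow_mul (abs_nonneg _), abs_sub_comm (t : ℝ) s, mul_comm H, Nat.cast_two]
  ring

lemma IsFBM.map_sub (hB : IsFBM P H T B) (hH : 0 < H) (i : Fin m) (s t : Set.Icc (0 : ℝ) T) :
    P.map (fun ω => B s ω i - B t ω i) =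
      (gaussianReal 0 1).map (fun y => |(s : ℝ) - t| ^ H * y) := by
  rw [((hB.isGaussianProcess_coord i).hasGaussianLaw_fun_sub (s := s) (t := t)).map_eq_gaussianReal,
    gaussianReal_map_const_mul, mul_zero, mul_one, hB.variance_sub hH,
    integral_sub ((hB.memLp_coord i s).integrable one_le_two)
      ((hB.memLp_coord i t).integrable one_le_two), hB.centered, hB.centered, sub_zero]
  congr 1
  ext
  rw [Real.coe_toNNReal _ (by positivity)]
  rfl

lemma IsFBM.lintegral_enorm_sub_rpow (hB : IsFBM P H T B) (hH : 0 < H) (i : Fin m)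
    (s t : Set.Icc (0 : ℝ) T) {p : ℝ} (hp : 0 < p) :
    ∫⁻ ω, ‖B s ω i - B t ω i‖ₑ ^ p ∂P =
      (∫⁻ y, ‖y‖ₑ ^ p ∂gaussianReal 0 1) * edist s t ^ (H * p) := by
  have hmeas : AEMeasurable (fun ω => B s ω i - B t ω i) P :=
    (hB.memLp_coord i s).aemeasurable.sub (hB.memLp_coord i t).aemeasurable
  have hpow : Measurable fun y : ℝ => ‖y‖ₑ ^ p := by fun_prop
  have hscale : ∀ y : ℝ, ‖|(s : ℝ) - t| ^ H * y‖ₑ ^ p = ‖y‖ₑ ^ p * edist s t ^ (H * p) := by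
    intro y
    rw [enorm_mul, ENNReal.mul_rpow_of_nonneg _ _ hp.le, Real.enorm_of_nonneg (by positivity),
      edist_dist, Subtype.dist_eq, Real.dist_eq, ← ENNReal.ofReal_rpow_of_nonneg (by positivity)
      hH.le, ← ENNReal.rpow_mul, mul_comm]
  rw [← lintegral_map' (f := fun y : ℝ => ‖y‖ₑ ^ p) hpow.aemeasurable hmeas, hB.map_sub hH,
    lintegral_map hpow (by fun_prop)]
  simp only [hscale]
  rw [lintegral_mul_const _ hpow]

lemma IsFBM.exists_lintegral_edist_rpow_le (hB : IsFBM P H T B) (hH : 0 < H) {p : ℝ}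
    (hp : 1 ≤ p) : ∃ M : ℝ≥0, ∀ s t,
      ∫⁻ ω, edist (B s ω) (B t ω) ^ p ∂P ≤ M * edist s t ^ (H * p) := by
  have hp0 : 0 < p := one_pos.trans_le hp
  set c : ℝ≥0∞ := (m : ℝ≥0∞) ^ (p - 1) * ∑ _ : Fin m, ∫⁻ y, ‖y‖ₑ ^ p ∂gaussianReal 0 1
  have hfin : c < ∞ := ENNReal.mul_lt_top
    (ENNReal.rpow_lt_top_of_nonneg (sub_nonneg.2 hp) (ENNReal.natCast_ne_top m))
    (ENNReal.sum_lt_top.2 fun _ _ => lintegral_enorm_rpow_gaussianReal_lt_top 0 1 hp0)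
  refine ⟨c.toNNReal, fun s t => ?_⟩
  have hmeas : ∀ i, AEMeasurable (fun ω => ‖B s ω i - B t ω i‖ₑ ^ p) P := fun i =>
    ((hB.memLp_coord i s).aemeasurable.sub (hB.memLp_coord i t).aemeasurable).enorm.pow_const p
  calc ∫⁻ ω, edist (B s ω) (B t ω) ^ p ∂P
      ≤ ∫⁻ ω, (m : ℝ≥0∞) ^ (p - 1) * ∑ i, ‖B s ω i - B t ω i‖ₑ ^ p ∂P :=
        lintegral_mono fun ω => by
          rw [edist_eq_enorm_sub]
          exact enorm_rpow_le_mul_sum_enorm_rpow _ hp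
    _ = c * edist s t ^ (H * p) := by
        rw [lintegral_const_mul'' _ (Finset.aemeasurable_fun_sum _ fun i _ => hmeas i),
          lintegral_finsetSum' _ fun i _ => hmeas i]
        simp only [hB.lintegral_enorm_sub_rpow hH _ s t hp0]
        rw [← Finset.sum_mul, ← mul_assoc]
    _ = c.toNNReal * edist s t ^ (H * p) := by rw [ENNReal.coe_toNNReal hfin.ne]

lemma IsFBM.exists_isAEKolmogorovProcess (hB : IsFBM P H T B) (hH : 0 < H) {p : ℝ}
    (hp : 1 ≤ p) : ∃ M, IsAEKolmogorovProcess B P p (H * p) M := by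
  have hp0 : 0 < p := one_pos.trans_le hp
  have hmeas : ∀ t, AEMeasurable (B t) P := fun t =>
    (hB.gaussian.hasGaussianLaw_eval t).aemeasurable
  obtain ⟨M, hM⟩ := hB.exists_lintegral_edist_rpow_le hH hp
  refine ⟨M, fun t => (hmeas t).mk (B t),
    IsKolmogorovProcess.mk_of_secondCountableTopology (fun t => (hmeas t).measurable_mk)
      (fun s t => ?_) hp0 (mul_pos hH hp0), fun t => (hmeas t).ae_eq_mk⟩
  refine (lintegral_congr_ae ?_).trans_le (hM s t)
  filter_upwards [(hmeas s).ae_eq_mk, (hmeas t).ae_eq_mk] with ω hs ht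
  rw [hs, ht]

end Moments

/-! ### The singular kernel `|u - v|^{2H-2}` -/

lemma locallyIntegrable_abs_rpow {β : ℝ} (hβ : -1 < β) :
    LocallyIntegrable (fun x : ℝ => |x| ^ β) := by
  refine locallyIntegrable_of_norm_le_rpow (C := 1) (α := -β) (by simp)
    (by rw [Module.finrank_self, Nat.cast_one]; linarith) (ae_of_all _ fun x => ?_)
    (by fun_prop : Measurable _).aestronglyMeasurable
  rw [Real.norm_eq_abs, Real.norm_eq_abs, neg_neg, one_mul, abs_of_nonneg (by positivity)]

lemma intervalIntegrable_abs_rpow {β : ℝ} (hβ : -1 < β) (a b : ℝ) :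
    IntervalIntegrable (fun x : ℝ => |x| ^ β) volume a b :=
  ((locallyIntegrable_abs_rpow hβ).integrableOn_isCompact isCompact_uIcc).intervalIntegrable

lemma continuous_abs_rpow_mul {β : ℝ} (hβ : -1 < β) : Continuous fun x : ℝ => |x| ^ β * x := by
  refine continuous_iff_continuousAt.2 fun x => ?_
  by_cases hx : x = 0
  · subst hx
    rw [ContinuousAt, mul_zero]
    refine squeeze_zero_norm (a := fun x : ℝ => |x| ^ (β + 1)) (fun x => ?_) ?_
    · rcases eq_or_ne x 0 with rfl | h
      · rw [mul_zero, norm_zero]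
        positivity
      · rw [norm_mul, Real.norm_eq_abs, Real.norm_eq_abs, abs_of_nonneg (by positivity),
          Real.rpow_add_one (abs_ne_zero.2 h)]
    · have hcont : Continuous fun x : ℝ => |x| ^ (β + 1) :=
        continuous_abs.rpow_const fun _ => Or.inr (by linarith)
      simpa [Real.zero_rpow (by linarith : β + 1 ≠ 0)] using hcont.tendsto 0
  · exact (continuousAt_id.abs.rpow_const (Or.inl (abs_ne_zero.2 hx))).mul continuousAt_id

lemma hasDerivAt_abs_rpow_mul {β x : ℝ} (hx : x ≠ 0) :
    HasDerivAt (fun x : ℝ => |x| ^ β * x) ((β + 1) * |x| ^ β) x := by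
  rcases lt_or_gt_of_ne hx with h | h
  · have hpow : HasDerivAt (fun x : ℝ => -(-x) ^ (β + 1)) ((β + 1) * |x| ^ β) x := by
      have := ((hasDerivAt_neg x).rpow_const (p := β + 1) (Or.inl (by linarith))).neg
      rw [abs_of_neg h]
      refine this.congr_deriv ?_
      rw [add_sub_cancel_right]
      ring
    refine hpow.congr_of_eventuallyEq ?_
    filter_upwards [Iio_mem_nhds h] with y hy
    have hy : y < 0 := hy
    rw [abs_of_neg hy, Real.rpow_add_one (by linarith)]
    ring
  · have hpow : HasDerivAt (fun x : ℝ => x ^ (β + 1)) ((β + 1) * |x| ^ β) x := by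
      have := (hasDerivAt_id x).rpow_const (p := β + 1) (Or.inl hx)
      rw [abs_of_pos h]
      refine this.congr_deriv ?_
      rw [add_sub_cancel_right, one_mul, id]
    refine hpow.congr_of_eventuallyEq ?_
    filter_upwards [Ioi_mem_nhds h] with y hy
    have hy : 0 < y := hy
    rw [abs_of_pos hy, Real.rpow_add_one hy.ne']

lemma integral_abs_rpow {β : ℝ} (hβ : -1 < β) (a b : ℝ) :
    ∫ x in a..b, |x| ^ β = (|b| ^ β * b - |a| ^ β * a) / (β + 1) := by
  have hFTC := integral_eq_of_hasDerivAt_off_countable (fun x : ℝ => |x| ^ β * x)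
    (fun x => (β + 1) * |x| ^ β) (a := a) (b := b) (Set.countable_singleton 0)
    (continuous_abs_rpow_mul hβ).continuousOn (fun x hx => hasDerivAt_abs_rpow_mul hx.2)
    ((intervalIntegrable_abs_rpow hβ a b).const_mul _)
  rw [intervalIntegral.integral_const_mul] at hFTC
  rw [← hFTC]
  field_simp [show β + 1 ≠ 0 by linarith]

lemma integral_abs_rpow_mul {H : ℝ} (hH : 1 / 2 < H) (a b : ℝ) :
    ∫ x in a..b, |x| ^ (2 * H - 2) * x = (|b| ^ (2 * H) - |a| ^ (2 * H)) / (2 * H) := by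
  rw [sub_div]
  refine intervalIntegral.integral_eq_sub_of_hasDerivAt
    (f := fun x => |x| ^ (2 * H) / (2 * H)) (fun x _ => ?_) ?_
  · have := (hasDerivAt_abs_rpow x (p := 2 * H) (by linarith)).div_const (2 * H)
    refine this.congr_deriv ?_
    rw [mul_assoc, mul_div_cancel_left₀ _ (by linarith)]
  · exact (continuous_abs_rpow_mul (by linarith)).intervalIntegrable _ _

lemma integral_integral_abs_sub_rpow {H : ℝ} (hH : 1 / 2 < H) (s t : ℝ) :
    H * (2 * H - 1) * ∫ v in (0 : ℝ)..t, ∫ u in (0 : ℝ)..s, |u - v| ^ (2 * H - 2) =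
      (|t| ^ (2 * H) + |s| ^ (2 * H) - |t - s| ^ (2 * H)) / 2 := by
  have hβ : -1 < 2 * H - 2 := by linarith
  have hcont := continuous_abs_rpow_mul hβ
  have hinner : ∀ v : ℝ, ∫ u in (0 : ℝ)..s, |u - v| ^ (2 * H - 2) =
      (|v| ^ (2 * H - 2) * v - |v - s| ^ (2 * H - 2) * (v - s)) / (2 * H - 1) := by
    intro v
    rw [intervalIntegral.integral_comp_sub_right (fun x => |x| ^ (2 * H - 2)) v,
      integral_abs_rpow hβ, zero_sub, abs_neg, abs_sub_comm s v]
    congr 1 <;> ring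
  simp only [hinner]
  have hcont_sub : Continuous fun v : ℝ => |v - s| ^ (2 * H - 2) * (v - s) :=
    hcont.comp (continuous_id.sub continuous_const)
  rw [intervalIntegral.integral_div, intervalIntegral.integral_sub
    (hcont.intervalIntegrable _ _) (hcont_sub.intervalIntegrable _ _),
    intervalIntegral.integral_comp_sub_right (fun x => |x| ^ (2 * H - 2) * x) s,
    integral_abs_rpow_mul hH, integral_abs_rpow_mul hH, zero_sub, abs_neg, abs_zero,
    Real.zero_rpow (by linarith)]
  have h2H : 2 * H - 1 ≠ 0 := by linarith
  have hH0 : H ≠ 0 := by linarith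
  rw [mul_assoc, mul_div_cancel₀ _ h2H]
  field_simp
  ring

/-- Lebesgue measure on `[0,T]`, against which `⟨f, g⟩_ℋ` is an iterated integral. -/
noncomputable abbrev intervalMeasure (T : ℝ) : Measure ℝ := volume.restrict (Set.Icc 0 T)

lemma lintegral_abs_sub_rpow_lt_top {β : ℝ} (hβ : -1 < β) (T : ℝ) :
    ∫⁻ v, ∫⁻ u, ENNReal.ofReal (|u - v| ^ β) ∂intervalMeasure T ∂intervalMeasure T < ∞ := by
  set C : ℝ≥0∞ := ∫⁻ x in Set.Icc (-T) T, ENNReal.ofReal (|x| ^ β) with hC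
  have hCtop : C < ∞ :=
    ((locallyIntegrable_abs_rpow hβ).integrableOn_isCompact isCompact_Icc).lintegral_lt_top
  have hle : ∀ v ∈ Set.Icc 0 T, ∫⁻ u, ENNReal.ofReal (|u - v| ^ β) ∂intervalMeasure T ≤ C := by
    intro v hv
    rw [hC, ← lintegral_indicator measurableSet_Icc, ← lintegral_indicator measurableSet_Icc,
      ← lintegral_sub_right_eq_self (Set.indicator (Set.Icc (-T) T) _) v]
    refine lintegral_mono fun u => ?_
    by_cases hu : u ∈ Set.Icc 0 T
    · rw [Set.indicator_of_mem hu, Set.indicator_of_mem]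
      exact ⟨by linarith [hu.1, hv.2], by linarith [hu.2, hv.1]⟩
    · rw [Set.indicator_of_notMem hu]
      exact zero_le
  calc _ ≤ ∫⁻ _, C ∂intervalMeasure T :=
        lintegral_mono_ae ((ae_restrict_iff' measurableSet_Icc).2 (ae_of_all _ hle))
    _ < ∞ := by
        rw [lintegral_const, Measure.restrict_apply_univ]
        exact ENNReal.mul_lt_top hCtop measure_Icc_lt_top

lemma integrable_abs_sub_rpow {β : ℝ} (hβ : -1 < β) (T : ℝ) :
    Integrable (fun p : ℝ × ℝ => |p.2 - p.1| ^ β)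
      ((intervalMeasure T).prod (intervalMeasure T)) := by
  have hm : Measurable fun p : ℝ × ℝ => |p.2 - p.1| ^ β := by fun_prop
  refine ⟨hm.aestronglyMeasurable, ?_⟩
  rw [hasFiniteIntegral_iff_enorm, lintegral_prod _ hm.enorm.aemeasurable]
  refine lt_of_le_of_lt (le_of_eq ?_) (lintegral_abs_sub_rpow_lt_top hβ T)
  simp only [Real.enorm_of_nonneg (Real.rpow_nonneg (abs_nonneg _) _)]

/-! ### The inner product of `ℋ` on bounded functions -/

section InnerH

variable {T H : ℝ} {f g : ℝ → ℝ}

lemma integrable_mul_mul_abs_sub_rpow (hf : MemLp f ∞ (intervalMeasure T))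
    (hg : MemLp g ∞ (intervalMeasure T)) {β : ℝ} (hβ : -1 < β) :
    Integrable (fun p : ℝ × ℝ => f p.2 * g p.1 * |p.2 - p.1| ^ β)
      ((intervalMeasure T).prod (intervalMeasure T)) :=
  (integrable_abs_sub_rpow hβ T).mul_of_top_right ((hg.comp_fst _).mul (hf.comp_snd _))

lemma innerH_eq_integral_prod (hH : 1 / 2 < H) (hf : MemLp f ∞ (intervalMeasure T))
    (hg : MemLp g ∞ (intervalMeasure T)) :
    innerH H T f g = H * (2 * H - 1) * ∫ p : ℝ × ℝ, f p.2 * g p.1 * |p.2 - p.1| ^ (2 * H - 2)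
      ∂(intervalMeasure T).prod (intervalMeasure T) := by
  rw [integral_prod _ (integrable_mul_mul_abs_sub_rpow hf hg (by linarith)), innerH]

lemma memAbsH_of_memLp_top (hH : 1 / 2 < H) (hf : MemLp f ∞ (intervalMeasure T)) :
    MemAbsH H T f := by
  have hint := integrable_mul_mul_abs_sub_rpow hf hf (β := 2 * H - 2) (by linarith)
  have hfin := hint.hasFiniteIntegral
  rw [hasFiniteIntegral_iff_enorm, lintegral_prod _ hint.1.enorm] at hfin
  refine ⟨hf.1.aemeasurable, hfin.trans_eq' ?_⟩
  simp only [← ofReal_norm, norm_mul, Real.norm_eq_abs,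
    abs_of_nonneg (Real.rpow_nonneg (abs_nonneg _) _)]

lemma innerH_add_add_innerH_sub (hH : 1 / 2 < H) (hf : MemLp f ∞ (intervalMeasure T))
    (hg : MemLp g ∞ (intervalMeasure T)) :
    innerH H T (f + g) (f + g) + innerH H T (f - g) (f - g) =
      2 * innerH H T f f + 2 * innerH H T g g := by
  have hβ : -1 < 2 * H - 2 := by linarith
  rw [innerH_eq_integral_prod hH (hf.add hg) (hf.add hg),
    innerH_eq_integral_prod hH (hf.sub hg) (hf.sub hg), innerH_eq_integral_prod hH hf hf,
    innerH_eq_integral_prod hH hg hg, ← mul_add, mul_left_comm, mul_left_comm 2, ← mul_add,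
    ← integral_const_mul, ← integral_const_mul,
    ← integral_add (integrable_mul_mul_abs_sub_rpow (hf.add hg) (hf.add hg) hβ)
      (integrable_mul_mul_abs_sub_rpow (hf.sub hg) (hf.sub hg) hβ),
    ← integral_add ((integrable_mul_mul_abs_sub_rpow hf hf hβ).const_mul 2)
      ((integrable_mul_mul_abs_sub_rpow hg hg hβ).const_mul 2)]
  congr 2
  funext p
  simp only [Pi.add_apply, Pi.sub_apply]
  ring

lemma tendsto_innerH_self (hH : 1 / 2 < H) {F : ℕ → ℝ → ℝ} {M : ℝ}
    (hF : ∀ n, AEStronglyMeasurable (F n) (intervalMeasure T))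
    (hM : ∀ n, ∀ᵐ u ∂intervalMeasure T, |F n u| ≤ M)
    (hlim : ∀ᵐ u ∂intervalMeasure T, Tendsto (fun n => F n u) atTop (𝓝 (f u))) :
    Tendsto (fun n => innerH H T (F n) (F n)) atTop (𝓝 (innerH H T f f)) := by
  have hβ : -1 < 2 * H - 2 := by linarith
  have hFtop : ∀ n, MemLp (F n) ∞ (intervalMeasure T) := fun n => memLp_top_of_bound (hF n) M (hM n)
  have hfM : ∀ᵐ u ∂intervalMeasure T, |f u| ≤ M := by
    filter_upwards [ae_all_iff.2 hM, hlim] with u hu hlimu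
    exact le_of_tendsto' hlimu.abs hu
  have hftop : MemLp f ∞ (intervalMeasure T) :=
    memLp_top_of_bound (aestronglyMeasurable_of_tendsto_ae atTop hF hlim) M hfM
  have hsnd : Measure.QuasiMeasurePreserving Prod.snd
      ((intervalMeasure T).prod (intervalMeasure T)) (intervalMeasure T) :=
    Measure.quasiMeasurePreserving_snd
  have hfst : Measure.QuasiMeasurePreserving Prod.fst
      ((intervalMeasure T).prod (intervalMeasure T)) (intervalMeasure T) :=
    Measure.quasiMeasurePreserving_fst
  simp only [innerH_eq_integral_prod hH (hFtop _) (hFtop _),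
    innerH_eq_integral_prod hH hftop hftop]
  refine Tendsto.const_mul _ (tendsto_integral_of_dominated_convergence
    (fun p => M * M * |p.2 - p.1| ^ (2 * H - 2))
    (fun n => (integrable_mul_mul_abs_sub_rpow (hFtop n) (hFtop n) hβ).aestronglyMeasurable)
    ((integrable_abs_sub_rpow hβ T).const_mul (M * M)) (fun n => ?_) ?_)
  · filter_upwards [hsnd.ae (hM n), hfst.ae (hM n)] with p hp₂ hp₁
    rw [norm_mul, norm_mul, Real.norm_of_nonneg (Real.rpow_nonneg (abs_nonneg _) _)]
    exact mul_le_mul_of_nonneg_right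
      (mul_le_mul hp₂ hp₁ (abs_nonneg _) ((abs_nonneg _).trans hp₂))
      (Real.rpow_nonneg (abs_nonneg _) _)
  · filter_upwards [hsnd.ae hlim, hfst.ae hlim] with p hp₂ hp₁
    exact (hp₂.mul hp₁).mul_const _

end InnerH

/-! ### Step functions and their Wiener integrals -/

section StepFunctions

variable {T H : ℝ}

lemma stepFun_eq_linearCombination (c : Set.Icc (0 : ℝ) T →₀ ℝ) :
    stepFun c = Finsupp.linearCombination ℝ
      (fun t : Set.Icc (0 : ℝ) T => (Set.Icc (0 : ℝ) t).indicator fun _ => (1 : ℝ)) c := by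
  funext r
  simp only [stepFun, Finsupp.linearCombination_apply, Finsupp.sum, Finset.sum_apply,
    Pi.smul_apply, smul_eq_mul]

lemma stepFun_add (c d : Set.Icc (0 : ℝ) T →₀ ℝ) : stepFun (c + d) = stepFun c + stepFun d := by
  simp only [stepFun_eq_linearCombination, map_add]

lemma stepFun_sub (c d : Set.Icc (0 : ℝ) T →₀ ℝ) : stepFun (c - d) = stepFun c - stepFun d := by
  simp only [stepFun_eq_linearCombination, map_sub]

lemma memLp_top_indicator_one (t : ℝ) :
    MemLp ((Set.Icc (0 : ℝ) t).indicator fun _ => (1 : ℝ)) ∞ (intervalMeasure T) :=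
  (memLp_top_const 1).indicator measurableSet_Icc

lemma memLp_top_stepFun (c : Set.Icc (0 : ℝ) T →₀ ℝ) :
    MemLp (stepFun c) ∞ (intervalMeasure T) :=
  memLp_finsetSum _ fun t _ => (memLp_top_indicator_one (t : ℝ)).const_mul (c t)

lemma setIntegral_indicator_one_mul (t : Set.Icc (0 : ℝ) T) (φ : ℝ → ℝ) :
    ∫ v in Set.Icc 0 T, (Set.Icc (0 : ℝ) t).indicator (fun _ => (1 : ℝ)) v * φ v =
      ∫ v in (0 : ℝ)..t, φ v := by
  simp only [← Set.indicator_mul_left, one_mul]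
  rw [setIntegral_indicator measurableSet_Icc,
    Set.inter_eq_self_of_subset_right (Set.Icc_subset_Icc_right t.2.2),
    integral_Icc_eq_integral_Ioc, intervalIntegral.integral_of_le t.2.1]

lemma innerH_indicator_indicator (hH : 1 / 2 < H) (s t : Set.Icc (0 : ℝ) T) :
    innerH H T ((Set.Icc (0 : ℝ) s).indicator fun _ => (1 : ℝ))
      ((Set.Icc (0 : ℝ) t).indicator fun _ => (1 : ℝ)) =
      (|(t : ℝ)| ^ (2 * H) + |(s : ℝ)| ^ (2 * H) - |(t : ℝ) - (s : ℝ)| ^ (2 * H)) / 2 := by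
  simp only [← integral_integral_abs_sub_rpow hH, innerH, mul_assoc,
    setIntegral_indicator_one_mul s, intervalIntegral.integral_const_mul,
    setIntegral_indicator_one_mul t]

lemma integral_sum_sum_mul {ι X : Type*} [MeasurableSpace X] {μ : Measure X} {F : ι → ι → X → ℝ}
    (S : Finset ι) (c : ι → ℝ) (hF : ∀ s t, Integrable (F s t) μ) :
    ∫ x, ∑ s ∈ S, ∑ t ∈ S, c s * c t * F s t x ∂μ =
      ∑ s ∈ S, ∑ t ∈ S, c s * c t * ∫ x, F s t x ∂μ := by
  rw [integral_finsetSum _ fun s _ => integrable_finsetSum _ fun t _ => (hF s t).const_mul _]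
  refine Finset.sum_congr rfl fun s _ => ?_
  rw [integral_finsetSum _ fun t _ => (hF s t).const_mul _]
  simp only [integral_const_mul]

lemma innerH_stepFun (hH : 1 / 2 < H) (c : Set.Icc (0 : ℝ) T →₀ ℝ) :
    innerH H T (stepFun c) (stepFun c) = ∑ s ∈ c.support, ∑ t ∈ c.support, c s * c t *
      ((|(t : ℝ)| ^ (2 * H) + |(s : ℝ)| ^ (2 * H) - |(t : ℝ) - (s : ℝ)| ^ (2 * H)) / 2) := by
  have hexpand : ∀ p : ℝ × ℝ, stepFun c p.2 * stepFun c p.1 * |p.2 - p.1| ^ (2 * H - 2) =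
      ∑ s ∈ c.support, ∑ t ∈ c.support, c s * c t *
        ((Set.Icc (0 : ℝ) s).indicator (fun _ => (1 : ℝ)) p.2 *
          (Set.Icc (0 : ℝ) t).indicator (fun _ => (1 : ℝ)) p.1 * |p.2 - p.1| ^ (2 * H - 2)) := by
    intro p
    rw [stepFun, stepFun, Finsupp.sum, Finsupp.sum, Finset.sum_mul_sum]
    simp only [Finset.sum_mul]
    exact Finset.sum_congr rfl fun s _ => Finset.sum_congr rfl fun t _ => by ring
  rw [innerH_eq_integral_prod hH (memLp_top_stepFun c) (memLp_top_stepFun c)]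
  simp only [hexpand]
  rw [integral_sum_sum_mul c.support c fun s t => integrable_mul_mul_abs_sub_rpow
    (memLp_top_indicator_one (s : ℝ)) (memLp_top_indicator_one (t : ℝ)) (by linarith)]
  simp only [Finset.mul_sum, ← innerH_indicator_indicator hH,
    innerH_eq_integral_prod hH (memLp_top_indicator_one _) (memLp_top_indicator_one _)]
  exact Finset.sum_congr rfl fun s _ => Finset.sum_congr rfl fun t _ => by ring

lemma stepIntegral_eq_linearCombination {Ω : Type*} (b : Set.Icc (0 : ℝ) T → Ω → ℝ)
    (c : Set.Icc (0 : ℝ) T →₀ ℝ) : stepIntegral b c = Finsupp.linearCombination ℝ b c := by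
  funext ω
  simp only [stepIntegral, Finsupp.linearCombination_apply, Finsupp.sum, Finset.sum_apply,
    Pi.smul_apply, smul_eq_mul]

lemma stepIntegral_sub {Ω : Type*} (b : Set.Icc (0 : ℝ) T → Ω → ℝ)
    (c d : Set.Icc (0 : ℝ) T →₀ ℝ) :
    stepIntegral b (c - d) = stepIntegral b c - stepIntegral b d := by
  simp only [stepIntegral_eq_linearCombination, map_sub]

variable {Ω : Type*} [MeasurableSpace Ω] {P : Measure Ω} {b : Set.Icc (0 : ℝ) T → Ω → ℝ}

/-- The real process `b` on `[0,T]` is square integrable and has the second moments of a fractional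
Brownian motion with Hurst parameter `H`; this is all that its Wiener integral requires. -/
structure HasFBMCovariance (P : Measure Ω) (H : ℝ) (b : Set.Icc (0 : ℝ) T → Ω → ℝ) : Prop where
  memLp : ∀ t, MemLp (b t) 2 P
  integral_mul : ∀ s t : Set.Icc (0 : ℝ) T, ∫ ω, b s ω * b t ω ∂P =
    (|(t : ℝ)| ^ (2 * H) + |(s : ℝ)| ^ (2 * H) - |(t : ℝ) - (s : ℝ)| ^ (2 * H)) / 2

namespace HasFBMCovariance

lemma memLp_stepIntegral (hb : HasFBMCovariance P H b) (c : Set.Icc (0 : ℝ) T →₀ ℝ) :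
    MemLp (stepIntegral b c) 2 P :=
  memLp_finsetSum _ fun t _ => (hb.memLp t).const_mul (c t)

lemma integral_stepIntegral_sq (hb : HasFBMCovariance P H b) (hH : 1 / 2 < H)
    (c : Set.Icc (0 : ℝ) T →₀ ℝ) :
    ∫ ω, stepIntegral b c ω ^ 2 ∂P = innerH H T (stepFun c) (stepFun c) := by
  have hexpand : ∀ ω, stepIntegral b c ω ^ 2 =
      ∑ s ∈ c.support, ∑ t ∈ c.support, c s * c t * (b s ω * b t ω) := by
    intro ω
    rw [sq, stepIntegral, Finsupp.sum, Finset.sum_mul_sum]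
    exact Finset.sum_congr rfl fun s _ => Finset.sum_congr rfl fun t _ => by ring
  simp only [hexpand]
  rw [integral_sum_sum_mul (F := fun s t ω => b s ω * b t ω) c.support c
    fun s t => (hb.memLp s).integrable_mul (hb.memLp t), innerH_stepFun hH]
  simp only [hb.integral_mul]

lemma innerH_stepFun_nonneg (hb : HasFBMCovariance P H b) (hH : 1 / 2 < H)
    (c : Set.Icc (0 : ℝ) T →₀ ℝ) : 0 ≤ innerH H T (stepFun c) (stepFun c) := by
  rw [← hb.integral_stepIntegral_sq hH]
  exact integral_nonneg fun _ => sq_nonneg _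

lemma eLpNorm_stepIntegral (hb : HasFBMCovariance P H b) (hH : 1 / 2 < H)
    (c : Set.Icc (0 : ℝ) T →₀ ℝ) :
    eLpNorm (stepIntegral b c) 2 P =
      ENNReal.ofReal (innerH H T (stepFun c) (stepFun c) ^ (2 : ℝ)⁻¹) := by
  rw [(hb.memLp_stepIntegral c).eLpNorm_eq_integral_rpow_norm two_ne_zero ENNReal.ofNat_ne_top,
    ← hb.integral_stepIntegral_sq hH]
  simp only [ENNReal.toReal_ofNat, Real.rpow_ofNat, Real.norm_eq_abs, sq_abs]

end HasFBMCovariance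

end StepFunctions

/-! ### Existence and uniqueness of Wiener integrals -/

section WienerIntegral

variable {Ω : Type*} [MeasurableSpace Ω] {P : Measure Ω} {H T : ℝ}
  {b : Set.Icc (0 : ℝ) T → Ω → ℝ} {h g : ℝ → ℝ}

lemma tendsto_of_abs_sub_le_one_div_mul {x : ℕ → ℝ} {y C : ℝ}
    (hx : ∀ n : ℕ, |y - x n| ≤ 1 / ((n : ℝ) + 1) * C) : Tendsto x atTop (𝓝 y) := by
  have hlim := tendsto_one_div_add_atTop_nhds_zero_nat (𝕜 := ℝ).mul_const C
  rw [zero_mul] at hlim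
  refine tendsto_iff_norm_sub_tendsto_zero.2 (squeeze_zero (fun _ => norm_nonneg _) (fun n => ?_)
    hlim)
  rw [norm_sub_rev]
  exact hx n

/-- `h` is a uniform limit of step functions, almost everywhere on `[0,T]`. On such functions the
inner product of `ℋ` inherits its positivity from the isometry on step functions. -/
def StepApproximable (T : ℝ) (h : ℝ → ℝ) : Prop :=
  ∀ ε > 0, ∃ c : Set.Icc (0 : ℝ) T →₀ ℝ, ∀ᵐ u ∂intervalMeasure T, |h u - stepFun c u| ≤ ε

lemma stepApproximable_stepFun (c : Set.Icc (0 : ℝ) T →₀ ℝ) : StepApproximable T (stepFun c) :=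
  fun ε hε => ⟨c, ae_of_all _ fun u => by rw [sub_self, abs_zero]; exact hε.le⟩

namespace StepApproximable

lemma add (hh : StepApproximable T h) (hg : StepApproximable T g) :
    StepApproximable T (h + g) := by
  intro ε hε
  obtain ⟨c, hc⟩ := hh (ε / 2) (half_pos hε)
  obtain ⟨d, hd⟩ := hg (ε / 2) (half_pos hε)
  refine ⟨c + d, ?_⟩
  filter_upwards [hc, hd] with u hcu hdu
  rw [stepFun_add, Pi.add_apply, Pi.add_apply, add_sub_add_comm, ← add_halves ε]
  exact (abs_add_le _ _).trans (add_le_add hcu hdu)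

lemma sub (hh : StepApproximable T h) (hg : StepApproximable T g) :
    StepApproximable T (h - g) := by
  intro ε hε
  obtain ⟨c, hc⟩ := hh (ε / 2) (half_pos hε)
  obtain ⟨d, hd⟩ := hg (ε / 2) (half_pos hε)
  refine ⟨c - d, ?_⟩
  filter_upwards [hc, hd] with u hcu hdu
  rw [stepFun_sub, Pi.sub_apply, Pi.sub_apply, sub_sub_sub_comm, ← add_halves ε]
  exact (abs_sub _ _).trans (add_le_add hcu hdu)

lemma exists_seq (hh : StepApproximable T h) : ∃ c : ℕ → (Set.Icc (0 : ℝ) T →₀ ℝ),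
    ∀ᵐ u ∂intervalMeasure T, ∀ n : ℕ, |h u - stepFun (c n) u| ≤ 1 / ((n : ℝ) + 1) := by
  choose c hc using fun n : ℕ => hh (1 / ((n : ℝ) + 1)) Nat.one_div_pos_of_nat
  exact ⟨c, ae_all_iff.2 hc⟩

lemma memLp_top (hh : StepApproximable T h) : MemLp h ∞ (intervalMeasure T) := by
  obtain ⟨c, hc⟩ := hh.exists_seq
  have hmeas : AEStronglyMeasurable h (intervalMeasure T) := by
    refine aestronglyMeasurable_of_tendsto_ae atTop (fun n => (memLp_top_stepFun (c n)).1) ?_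
    filter_upwards [hc] with u hu
    exact tendsto_of_abs_sub_le_one_div_mul (C := 1) (by simpa only [mul_one] using hu)
  have hdiff : MemLp (h - stepFun (c 0)) ∞ (intervalMeasure T) := by
    refine memLp_top_of_bound (hmeas.sub (memLp_top_stepFun (c 0)).1) (1 / ((0 : ℕ) + 1)) ?_
    filter_upwards [hc] with u hu
    exact hu 0
  simpa only [sub_add_cancel] using hdiff.add (memLp_top_stepFun (c 0))

lemma innerH_self_nonneg (hh : StepApproximable T h) (hb : HasFBMCovariance P H b)
    (hH : 1 / 2 < H) : 0 ≤ innerH H T h h := by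
  obtain ⟨c, hc⟩ := hh.exists_seq
  refine ge_of_tendsto' (tendsto_innerH_self hH (M := lpNorm h ∞ (intervalMeasure T) + 1)
    (fun n => (memLp_top_stepFun (c n)).1) (fun n => ?_) ?_) fun n =>
    hb.innerH_stepFun_nonneg hH (c n)
  · filter_upwards [hc, ae_le_lpNorm_exponent_top hh.memLp_top] with u hu hhu
    have hone : 1 / ((n : ℝ) + 1) ≤ 1 := by
      rw [div_le_one₀ n.cast_add_one_pos]
      linarith [n.cast_nonneg (α := ℝ)]
    have := abs_sub_abs_le_abs_sub (stepFun (c n) u) (h u)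
    rw [abs_sub_comm] at this
    rw [Real.norm_eq_abs] at hhu
    linarith [hu n]
  · filter_upwards [hc] with u hu
    exact tendsto_of_abs_sub_le_one_div_mul (C := 1) (by simpa only [mul_one] using hu)

end StepApproximable

lemma isWienerIntegral_of_forall_exists (hb : HasFBMCovariance P H b) (hH : 1 / 2 < H)
    {X K : Ω → ℝ} (hK : MemLp K 2 P)
    (hX : ∀ ε > 0, ∃ c : Set.Icc (0 : ℝ) T →₀ ℝ,
      (∀ᵐ u ∂intervalMeasure T, |h u - stepFun c u| ≤ ε) ∧
        ∀ᵐ ω ∂P, |X ω - stepIntegral b c ω| ≤ ε * ‖K ω‖) :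
    IsWienerIntegral P H T b h X := by
  have hh : StepApproximable T h := fun ε hε => (hX ε hε).imp fun _ => And.left
  choose c hch hcX using fun n : ℕ => hX (1 / ((n : ℝ) + 1)) Nat.one_div_pos_of_nat
  have hI := fun n => hb.memLp_stepIntegral (c n)
  have hXmeas : AEStronglyMeasurable X P := by
    refine aestronglyMeasurable_of_tendsto_ae atTop (fun n => (hI n).1) ?_
    filter_upwards [ae_all_iff.2 hcX] with ω hω
    exact tendsto_of_abs_sub_le_one_div_mul hω
  have hle : ∀ n : ℕ, eLpNorm (X - stepIntegral b (c n)) 2 P ≤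
      ENNReal.ofReal (1 / ((n : ℝ) + 1)) * eLpNorm K 2 P :=
    fun n => eLpNorm_le_mul_eLpNorm_of_ae_le_mul (hcX n) 2
  refine ⟨memAbsH_of_memLp_top hH hh.memLp_top, ?_, c, ?_, ?_⟩
  · have hdiff : MemLp (X - stepIntegral b (c 0)) 2 P := ⟨hXmeas.sub (hI 0).1,
      (hle 0).trans_lt (ENNReal.mul_lt_top ENNReal.ofReal_lt_top hK.eLpNorm_lt_top)⟩
    simpa only [sub_add_cancel] using hdiff.add (hI 0)
  · have hzero : innerH H T 0 0 = 0 := by simp [innerH]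
    rw [← hzero]
    refine tendsto_innerH_self hH (M := 1)
      (fun n => (hh.memLp_top.sub (memLp_top_stepFun (c n))).1) (fun n => ?_) ?_
    · filter_upwards [hch n] with u hu
      refine hu.trans ?_
      rw [div_le_one₀ n.cast_add_one_pos]
      linarith [n.cast_nonneg (α := ℝ)]
    · filter_upwards [ae_all_iff.2 hch] with u hu
      exact squeeze_zero_norm hu tendsto_one_div_add_atTop_nhds_zero_nat
  · refine tendsto_of_tendsto_of_tendsto_of_le_of_le tendsto_const_nhds ?_ (fun _ => zero_le) hle
    simpa only [ENNReal.ofReal_zero, zero_mul] using ENNReal.Tendsto.mul_const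
      (ENNReal.tendsto_ofReal tendsto_one_div_add_atTop_nhds_zero_nat)
      (Or.inr hK.eLpNorm_lt_top.ne)

lemma innerH_stepFun_sub_le (hb : HasFBMCovariance P H b) (hH : 1 / 2 < H)
    (hh : StepApproximable T h) (c d : Set.Icc (0 : ℝ) T →₀ ℝ) :
    innerH H T (stepFun (c - d)) (stepFun (c - d)) ≤
      2 * innerH H T (h - stepFun c) (h - stepFun c) +
        2 * innerH H T (h - stepFun d) (h - stepFun d) := by
  have hc := hh.sub (stepApproximable_stepFun c)
  have hd := hh.sub (stepApproximable_stepFun d)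
  have hparallelogram := innerH_add_add_innerH_sub hH hd.memLp_top hc.memLp_top
  have hpos := (hd.add hc).innerH_self_nonneg hb hH
  rw [sub_sub_sub_cancel_left, ← stepFun_sub] at hparallelogram
  linarith

lemma tendsto_eLpNorm_stepIntegral_sub (hb : HasFBMCovariance P H b) (hH : 1 / 2 < H)
    (hh : StepApproximable T h) {c d : ℕ → (Set.Icc (0 : ℝ) T →₀ ℝ)}
    (hc : Tendsto (fun n => innerH H T (h - stepFun (c n)) (h - stepFun (c n))) atTop (𝓝 0))
    (hd : Tendsto (fun n => innerH H T (h - stepFun (d n)) (h - stepFun (d n))) atTop (𝓝 0)) :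
    Tendsto (fun n => eLpNorm (stepIntegral b (c n) - stepIntegral b (d n)) 2 P) atTop (𝓝 0) := by
  simp only [← stepIntegral_sub, hb.eLpNorm_stepIntegral hH]
  have hbound := (hc.const_mul 2).add (hd.const_mul 2)
  rw [mul_zero, add_zero] at hbound
  have hroot := (squeeze_zero (fun n => hb.innerH_stepFun_nonneg hH (c n - d n))
    (fun n => innerH_stepFun_sub_le hb hH hh (c n) (d n)) hbound).rpow_const
    (p := (2 : ℝ)⁻¹) (Or.inr (by norm_num))
  rw [Real.zero_rpow (by norm_num)] at hroot
  simpa only [ENNReal.ofReal_zero] using ENNReal.tendsto_ofReal hroot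

lemma IsWienerIntegral.ae_eq {X Y : Ω → ℝ} (hb : HasFBMCovariance P H b) (hH : 1 / 2 < H)
    (hh : StepApproximable T h) (hX : IsWienerIntegral P H T b h X)
    (hY : IsWienerIntegral P H T b h Y) : X =ᵐ[P] Y := by
  obtain ⟨-, hXL, c, hc, hcX⟩ := hX
  obtain ⟨-, hYL, d, hd, hdY⟩ := hY
  have hI := fun c => (hb.memLp_stepIntegral c).1
  have htriangle : ∀ n, eLpNorm (X - Y) 2 P ≤ eLpNorm (X - stepIntegral b (c n)) 2 P +
      eLpNorm (stepIntegral b (c n) - stepIntegral b (d n)) 2 P +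
        eLpNorm (Y - stepIntegral b (d n)) 2 P := by
    intro n
    have hsplit : X - Y = X - stepIntegral b (c n) +
        (stepIntegral b (c n) - stepIntegral b (d n)) - (Y - stepIntegral b (d n)) := by abel
    have hXc := hXL.1.sub (hI (c n))
    have hcd := (hI (c n)).sub (hI (d n))
    rw [hsplit]
    refine (eLpNorm_sub_le (hXc.add hcd) (hYL.1.sub (hI (d n))) one_le_two).trans ?_
    gcongr
    exact eLpNorm_add_le hXc hcd one_le_two
  have hlim := (hcX.add (tendsto_eLpNorm_stepIntegral_sub hb hH hh hc hd)).add hdY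
  rw [add_zero, add_zero] at hlim
  have hzero := le_antisymm (ge_of_tendsto' hlim htriangle) zero_le
  rw [eLpNorm_eq_zero_iff (hXL.1.sub hYL.1) two_ne_zero] at hzero
  filter_upwards [hzero] with ω hω
  exact sub_eq_zero.1 hω

end WienerIntegral

/-! ### Wiener integrals of power kernels -/

section Partition

variable {T : ℝ} {u : ℕ → Set.Icc (0 : ℝ) T}

lemma exists_partition_mesh_le {s t : Set.Icc (0 : ℝ) T} (hst : s ≤ t) {δ : ℝ} (hδ : 0 < δ) :
    ∃ (u : ℕ → Set.Icc (0 : ℝ) T) (n : ℕ), Monotone u ∧ u 0 = s ∧ u n = t ∧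
      ∀ k, (u (k + 1) : ℝ) - u k ≤ δ := by
  have hst' : (s : ℝ) ≤ t := hst
  obtain ⟨n, hn⟩ := Set.Icc.addNSMul_eq_right hst' hδ
  refine ⟨fun k => ⟨Set.Icc.addNSMul hst' δ k, Set.Icc_subset_Icc s.2.1 t.2.2 (Subtype.prop _)⟩, n,
    fun j k hjk => Set.Icc.monotone_addNSMul hst' hδ.le hjk,
    Subtype.ext (Set.Icc.addNSMul_zero hst'), Subtype.ext (hn n le_rfl), fun k => ?_⟩
  exact (le_abs_self _).trans (Set.Icc.abs_sub_addNSMul_le hst' hδ.le k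
    ⟨Set.Icc.monotone_addNSMul hst' hδ.le k.le_succ, le_rfl⟩)

lemma abs_indicator_Ioc_sub_sum_indicator_le {φ : ℝ → ℝ} {v : ℕ → ℝ} {ε : ℝ} {n : ℕ}
    (hv : Monotone v) (hε : 0 ≤ ε)
    (hφ : ∀ k < n, ∀ r ∈ Set.Ioc (v k) (v (k + 1)), |φ r - φ (v k)| ≤ ε) (r : ℝ) :
    |(Set.Ioc (v 0) (v n)).indicator φ r - ∑ k ∈ Finset.range n,
      (Set.Ioc (v k) (v (k + 1))).indicator (fun _ => φ (v k)) r| ≤ ε := by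
  induction n with
  | zero => simpa using hε
  | succ n ih =>
    rw [Finset.sum_range_succ]
    rcases le_or_gt r (v n) with hr | hr
    · have hlast : r ∉ Set.Ioc (v n) (v (n + 1)) := fun h => h.1.not_ge hr
      have hmem : r ∈ Set.Ioc (v 0) (v (n + 1)) ↔ r ∈ Set.Ioc (v 0) (v n) :=
        and_congr_right fun _ => iff_of_true (hr.trans (hv n.le_succ)) hr
      rw [Set.indicator_of_notMem hlast, add_zero, Set.indicator_eq_indicator hmem rfl]
      exact ih fun k hk => hφ k (hk.trans n.lt_succ_self)
    · have hmem : r ∈ Set.Ioc (v 0) (v (n + 1)) ↔ r ∈ Set.Ioc (v n) (v (n + 1)) :=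
        and_congr_left fun _ => iff_of_true ((hv n.zero_le).trans_lt hr) hr
      have hzero : ∀ k ∈ Finset.range n,
          (Set.Ioc (v k) (v (k + 1))).indicator (fun _ => φ (v k)) r = 0 := fun k hk =>
        Set.indicator_of_notMem (fun h => hr.not_ge (h.2.trans (hv (Finset.mem_range.1 hk)))) _
      rw [Finset.sum_eq_zero hzero, zero_add, Set.indicator_eq_indicator hmem rfl]
      by_cases h : r ∈ Set.Ioc (v n) (v (n + 1))
      · rw [Set.indicator_of_mem h, Set.indicator_of_mem h]
        exact hφ n n.lt_succ_self r h
      · rw [Set.indicator_of_notMem h, Set.indicator_of_notMem h, sub_zero, abs_zero]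
        exact hε

/-- The coefficients of the step function `∑ₖ φ(uₖ) 1_{(uₖ, uₖ₊₁]}`, the left-point interpolation of
`φ` over the first `n` intervals of the subdivision `u`. -/
noncomputable def leftStep (φ : ℝ → ℝ) (u : ℕ → Set.Icc (0 : ℝ) T) (n : ℕ) :
    Set.Icc (0 : ℝ) T →₀ ℝ :=
  ∑ k ∈ Finset.range n,
    (Finsupp.single (u (k + 1)) (φ (u k)) - Finsupp.single (u k) (φ (u k)))

lemma stepIntegral_leftStep {Ω : Type*} (b : Set.Icc (0 : ℝ) T → Ω → ℝ) (φ : ℝ → ℝ) (n : ℕ)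
    (ω : Ω) : stepIntegral b (leftStep φ u n) ω =
      ∑ k ∈ Finset.range n, φ (u k) * (b (u (k + 1)) ω - b (u k) ω) := by
  simp only [stepIntegral_eq_linearCombination, leftStep, map_sum, map_sub,
    Finsupp.linearCombination_single, Finset.sum_apply, Pi.sub_apply, Pi.smul_apply, smul_eq_mul,
    mul_sub]

lemma stepFun_leftStep (hu : Monotone u) (φ : ℝ → ℝ) (n : ℕ) {r : ℝ} (hr : 0 ≤ r) :
    stepFun (leftStep φ u n) r = ∑ k ∈ Finset.range n,
      (Set.Ioc (u k : ℝ) (u (k + 1))).indicator (fun _ => φ (u k)) r := by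
  simp only [stepFun_eq_linearCombination, leftStep, map_sum, map_sub,
    Finsupp.linearCombination_single, Finset.sum_apply, Pi.sub_apply, Pi.smul_apply, smul_eq_mul]
  refine Finset.sum_congr rfl fun k _ => ?_
  have hk : (u k : ℝ) ≤ u (k + 1) := hu k.le_succ
  simp only [Set.indicator_apply, Set.mem_Icc, Set.mem_Ioc, hr, true_and]
  split_ifs <;> grind

end Partition

section Kernel

open scoped NNReal

variable {T γ s t τ : ℝ} {u : ℕ → Set.Icc (0 : ℝ) T}

lemma abs_sub_rpow_sub_sub_rpow_le {r v δ : ℝ} (hγ : 0 < γ) (hvr : v < r) (hδ : r - v ≤ δ)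
    (hrt : r ≤ t) (htτ : t < τ) :
    |(τ - r) ^ (-γ) - (τ - v) ^ (-γ)| ≤ max 1 γ * (δ * (τ - t) ^ (-γ - 1)) := by
  have hτr : 0 < τ - r := by linarith
  have hmono : (τ - v) ^ (-γ) ≤ (τ - r) ^ (-γ) :=
    Real.rpow_le_rpow_of_nonpos hτr (by linarith) (by linarith)
  have hosc := rpow_neg_sub_rpow_neg_le hτr (sub_pos.2 hvr) hγ (Set.right_mem_Icc.2 zero_le_one)
  rw [Real.rpow_one, sub_add_sub_cancel] at hosc
  rw [abs_of_nonneg (sub_nonneg.2 hmono)]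
  refine hosc.trans (mul_le_mul_of_nonneg_left ?_ (zero_le_one.trans (le_max_left _ _)))
  exact mul_le_mul hδ (Real.rpow_le_rpow_of_nonpos (by linarith) (by linarith) (by linarith))
    (Real.rpow_nonneg hτr.le _) ((sub_pos.2 hvr).le.trans hδ)

lemma abs_kernel_sub_stepFun_leftStep_le {n : ℕ} {δ : ℝ} (hγ : 0 < γ) (hu : Monotone u)
    (hδ : ∀ k, (u (k + 1) : ℝ) - u k ≤ δ) (hn : u n < τ) :
    ∀ᵐ r ∂intervalMeasure T, |kernel γ (u 0) (u n) τ r -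
      stepFun (leftStep (fun v => (τ - v) ^ (-γ)) u n) r| ≤
        max 1 γ * (δ * (τ - u n) ^ (-γ - 1)) := by
  have hu' : Monotone fun k => (u k : ℝ) := hu
  have hδ0 : 0 ≤ δ := (sub_nonneg.2 (hu' zero_le_one)).trans (hδ 0)
  have hnull := indicator_ae_eq_of_ae_eq_set (f := fun r => (τ - r) ^ (-γ))
    (Ioc_ae_eq_Icc (μ := volume) (a := (u 0 : ℝ)) (b := u n))
  filter_upwards [ae_restrict_of_ae hnull, ae_restrict_mem measurableSet_Icc] with r hr hrT
  rw [kernel, ← hr, stepFun_leftStep hu _ n hrT.1]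
  refine abs_indicator_Ioc_sub_sum_indicator_le (v := fun k => (u k : ℝ)) hu' ?_
    (fun k hk v hv => ?_) r
  · positivity
  · exact abs_sub_rpow_sub_sub_rpow_le hγ hv.1 ((sub_le_sub_right hv.2 _).trans (hδ k))
      (hv.2.trans (hu' hk)) hn

lemma exists_leftStep_approx {a : ℝ≥0} (ha : 0 < a) (hγ : 0 < γ) (hs : 0 ≤ s) (hst : s ≤ t)
    (htτ : t < τ) (htT : t ≤ T) {ε : ℝ} (hε : 0 < ε) :
    ∃ (u : ℕ → Set.Icc (0 : ℝ) T) (n : ℕ),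
      (∀ᵐ r ∂intervalMeasure T, |kernel γ s t τ r -
        stepFun (leftStep (fun v => (τ - v) ^ (-γ)) u n) r| ≤ ε) ∧
      ∀ (K : ℝ≥0) (x : ℝ → ℝ), HolderWith K a x →
        |pathIntegral γ x s t τ - riemannSum γ x (fun k => u k) τ n| ≤ ε * K := by
  have hlim : Tendsto (fun δ : ℝ => max 1 γ * (δ * (τ - t) ^ (-γ - 1))) (𝓝[>] 0) (𝓝 0) := by
    refine (Continuous.tendsto' (by fun_prop) 0 0 (by ring)).mono_left nhdsWithin_le_nhds
  have hlim' : Tendsto (fun δ : ℝ => δ ^ (a : ℝ) * (τ - t) ^ (-γ)) (𝓝[>] 0) (𝓝 0) := by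
    refine (Continuous.tendsto' ?_ 0 0 ?_).mono_left nhdsWithin_le_nhds
    · exact (Real.continuous_rpow_const a.coe_nonneg).mul_const _
    · rw [Real.zero_rpow (by exact_mod_cast ha.ne'), zero_mul]
  obtain ⟨δ, hδε, hδε', hδ⟩ := ((hlim.eventually_le_const hε).and
    ((hlim'.eventually_le_const hε).and self_mem_nhdsWithin)).exists
  obtain ⟨u, n, hu, hu0, hun, huδ⟩ := exists_partition_mesh_le
    (s := ⟨s, hs, hst.trans htT⟩) (t := ⟨t, hs.trans hst, htT⟩) hst (Set.mem_Ioi.1 hδ)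
  have hs' : (u 0 : ℝ) = s := congrArg Subtype.val hu0
  have ht' : (u n : ℝ) = t := congrArg Subtype.val hun
  refine ⟨u, n, ?_, fun K x hx => ?_⟩
  · have hkernel := abs_kernel_sub_stepFun_leftStep_le hγ hu huδ (ht'.trans_lt htτ)
    rw [hs', ht'] at hkernel
    exact hkernel.mono fun r hr => hr.trans hδε
  · have hsum := norm_riemannSum_sub_pathIntegral_le (u := fun k => (u k : ℝ)) hx ha hγ hu huδ
      (ht'.trans_lt htτ)
    rw [hs', ht', norm_sub_rev, Real.norm_eq_abs] at hsum
    have : 0 ≤ (τ - s) ^ (-γ) := Real.rpow_nonneg (by linarith) _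
    calc _ ≤ _ := hsum
      _ ≤ K * δ ^ (a : ℝ) * (τ - t) ^ (-γ) := by gcongr; linarith
      _ ≤ ε * K := by rw [mul_assoc, mul_comm]; gcongr

lemma stepApproximable_kernel (hγ : 0 < γ) (hs : 0 ≤ s) (hst : s ≤ t) (htτ : t < τ)
    (htT : t ≤ T) : StepApproximable T (kernel γ s t τ) := by
  intro ε hε
  obtain ⟨u, n, hkernel, -⟩ := exists_leftStep_approx one_pos hγ hs hst htτ htT hε
  exact ⟨_, hkernel⟩

variable {Ω : Type*} [MeasurableSpace Ω] {P : Measure Ω} {H : ℝ} {b : Set.Icc (0 : ℝ) T → Ω → ℝ}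

lemma isWienerIntegral_pathIntegral {a : ℝ≥0} {x : Ω → ℝ → ℝ} {K : Ω → ℝ≥0}
    (hb : HasFBMCovariance P H b) (hH : 1 / 2 < H) (ha : 0 < a)
    (hx : ∀ ω, HolderWith (K ω) a (x ω)) (hxb : ∀ t : Set.Icc (0 : ℝ) T, ∀ᵐ ω ∂P, x ω t = b t ω)
    (hK : MemLp (fun ω => (K ω : ℝ)) 2 P) (hγ : 0 < γ) (hs : 0 ≤ s) (hst : s ≤ t) (htτ : t < τ)
    (htT : t ≤ T) :
    IsWienerIntegral P H T b (kernel γ s t τ) fun ω => pathIntegral γ (x ω) s t τ := by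
  refine isWienerIntegral_of_forall_exists hb hH hK fun ε hε => ?_
  obtain ⟨u, n, hkernel, hsum⟩ := exists_leftStep_approx ha hγ hs hst htτ htT hε
  refine ⟨_, hkernel, ?_⟩
  filter_upwards [ae_all_iff.2 fun k => hxb (u k)] with ω hω
  rw [stepIntegral_leftStep, NNReal.norm_eq]
  simpa only [riemannSum, hω, smul_eq_mul] using hsum (K ω) (x ω) (hx ω)

end Kernel

/-! ### Volterra norms of continuous processes -/

section VolterraNorm

open scoped NNReal

variable {T α γ η ζ : ℝ}

lemma exists_countable_subset_closure {X : Type*} [TopologicalSpace X]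
    [TopologicalSpace.PseudoMetrizableSpace X] [SecondCountableTopology X] (S : Set X) :
    ∃ D ⊆ S, D.Countable ∧ S ⊆ closure D :=
  (TopologicalSpace.IsSeparable.of_separableSpace S).exists_countable_dense_subset

lemma biSup_eq_of_subset_closure {X : Type*} [TopologicalSpace X] {S D : Set X} {f : X → ℝ≥0∞}
    (hf : ContinuousOn f S) (hDS : D ⊆ S) (hSD : S ⊆ closure D) :
    ⨆ x ∈ S, f x = ⨆ x ∈ D, f x := by
  refine le_antisymm (iSup₂_le fun x hx => ?_) (biSup_mono hDS)
  have hmem : f x ∈ closure (f '' D) := ((hf x hx).mono hDS).mem_closure_image (hSD hx)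
  have hle : f '' D ⊆ Set.Iic (⨆ x ∈ D, f x) := Set.image_subset_iff.2 fun _ hy => le_biSup f hy
  exact closure_minimal hle isClosed_Iic hmem

lemma aemeasurable_biSup_of_continuousOn {X Ω : Type*} [TopologicalSpace X]
    [TopologicalSpace.PseudoMetrizableSpace X] [SecondCountableTopology X] [MeasurableSpace Ω]
    {P : Measure Ω} {S : Set X} {f : Ω → X → ℝ≥0∞}
    (hmeas : ∀ x ∈ S, AEMeasurable (fun ω => f ω x) P) (hcont : ∀ᵐ ω ∂P, ContinuousOn (f ω) S) :
    AEMeasurable (fun ω => ⨆ x ∈ S, f ω x) P := by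
  obtain ⟨D, hDS, hD, hSD⟩ := exists_countable_subset_closure S
  refine (AEMeasurable.biSup D hD fun x hx => hmeas x (hDS hx)).congr ?_
  filter_upwards [hcont] with ω hω
  exact (biSup_eq_of_subset_closure hω hDS hSD).symm

lemma continuousOn_enorm_div {X E : Type*} [TopologicalSpace X] [NormedAddCommGroup E] {S : Set X}
    {f : X → E} {g : X → ℝ} (hf : ContinuousOn f S) (hg : ContinuousOn g S)
    (hpos : ∀ x ∈ S, 0 < g x) : ContinuousOn (fun x => ‖f x‖ₑ / ENNReal.ofReal (g x)) S := by
  have h : ContinuousOn (fun x => ENNReal.ofReal (‖f x‖ / g x)) S :=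
    ENNReal.continuous_ofReal.comp_continuousOn (hf.norm.div hg fun x hx => (hpos x hx).ne')
  refine h.congr fun x hx => ?_
  simp only [ENNReal.ofReal_div_of_pos (hpos x hx), ofReal_norm]

lemma continuousOn_abs_sub_rpow {X : Type*} [TopologicalSpace X] {S : Set X} {f g : X → ℝ}
    (hf : ContinuousOn f S) (hg : ContinuousOn g S) (hfg : ∀ x ∈ S, f x < g x) (p : ℝ) :
    ContinuousOn (fun x => |g x - f x| ^ p) S :=
  (hg.sub hf).abs.rpow_const fun x hx => Or.inl (abs_ne_zero.2 (sub_pos.2 (hfg x hx)).ne')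

lemma continuousOn_psi1 (T α γ : ℝ) :
    ContinuousOn (fun x : ℝ × ℝ × ℝ => psi1 α γ x.2.2 x.2.1 x.1) (simplex3 T) := by
  have hτt : ∀ p : ℝ, ContinuousOn (fun x : ℝ × ℝ × ℝ => |x.2.2 - x.2.1| ^ p) (simplex3 T) :=
    continuousOn_abs_sub_rpow (by fun_prop) (by fun_prop) fun x hx => hx.2.2.1
  have hts : ∀ p : ℝ, ContinuousOn (fun x : ℝ × ℝ × ℝ => |x.2.1 - x.1| ^ p) (simplex3 T) :=
    continuousOn_abs_sub_rpow (by fun_prop) (by fun_prop) fun x hx => hx.2.1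
  exact ((hτt _).mul (hts _)).inf (hts _)

lemma continuousOn_psi12 (T α γ η ζ : ℝ) :
    ContinuousOn (fun x : ℝ × ℝ × ℝ × ℝ => psi12 α γ η ζ x.2.2.2 x.2.2.1 x.2.1 x.1)
      (simplex4 T) := by
  have hττ' : ∀ p : ℝ, ContinuousOn (fun x : ℝ × ℝ × ℝ × ℝ => |x.2.2.2 - x.2.2.1| ^ p)
      (simplex4 T) :=
    continuousOn_abs_sub_rpow (by fun_prop) (by fun_prop) fun x hx => hx.2.2.2.1
  have hτ't : ∀ p : ℝ, ContinuousOn (fun x : ℝ × ℝ × ℝ × ℝ => |x.2.2.1 - x.2.1| ^ p)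
      (simplex4 T) :=
    continuousOn_abs_sub_rpow (by fun_prop) (by fun_prop) fun x hx => hx.2.2.1
  have hts : ∀ p : ℝ, ContinuousOn (fun x : ℝ × ℝ × ℝ × ℝ => |x.2.1 - x.1| ^ p) (simplex4 T) :=
    continuousOn_abs_sub_rpow (by fun_prop) (by fun_prop) fun x hx => hx.2.1
  exact ((hττ' _).mul (hτ't _)).mul (((hτ't _).mul (hts _)).inf (hts _))

lemma mem_simplex3_right {x : ℝ × ℝ × ℝ × ℝ} (hx : x ∈ simplex4 T) :
    (x.1, x.2.1, x.2.2.2) ∈ simplex3 T :=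
  ⟨hx.1, hx.2.1, hx.2.2.1.trans hx.2.2.2.1, hx.2.2.2.2⟩

lemma mem_simplex3_left {x : ℝ × ℝ × ℝ × ℝ} (hx : x ∈ simplex4 T) :
    (x.1, x.2.1, x.2.2.1) ∈ simplex3 T :=
  ⟨hx.1, hx.2.1, hx.2.2.1, hx.2.2.2.1.le.trans hx.2.2.2.2⟩

section NormedGroup

variable {E : Type*} [NormedAddCommGroup E] {z z' : ℝ → ℝ → ℝ → E}

lemma volterraNorm_congr (h : ∀ s t τ, (s, t, τ) ∈ simplex3 T → z s t τ = z' s t τ) :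
    volterraNorm T α γ η ζ z = volterraNorm T α γ η ζ z' := by
  refine congrArg₂ (· + ·) (biSup_congr fun x hx => ?_) (biSup_congr fun x hx => ?_)
  · rw [h _ _ _ hx]
  · rw [h _ _ _ (mem_simplex3_right hx), h _ _ _ (mem_simplex3_left hx)]

lemma enorm_div_ofReal_le {K : ℝ≥0} {v : E} {C ψ : ℝ} (hC : 0 ≤ C) (hψ : 0 < ψ)
    (hv : ‖v‖ ≤ C * (K * ψ)) : ‖v‖ₑ / ENNReal.ofReal ψ ≤ ENNReal.ofReal C * K := by
  rw [← ENNReal.ofReal_coe_nnreal, ← ENNReal.ofReal_mul hC, ← ofReal_norm,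
    ← ENNReal.ofReal_div_of_pos hψ]
  refine ENNReal.ofReal_le_ofReal ?_
  rwa [div_le_iff₀ hψ, mul_assoc]

lemma exists_volterraNorm_pathIntegral_le [NormedSpace ℝ E] [CompleteSpace E] {a : ℝ≥0}
    (hT : 0 ≤ T) (hγ : 0 < γ) (hζ : 0 ≤ ζ) (hζη : ζ ≤ η) (hη : η ≤ 1) (hγζa : γ + ζ < a)
    (hαa : α ≤ a) :
    ∃ C : ℝ≥0, ∀ (K : ℝ≥0) (x : ℝ → E), HolderWith K a x →
      volterraNorm T α γ η ζ (pathIntegral γ x) ≤ C * K := by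
  have hγa : γ < a := by linarith
  refine ⟨Real.toNNReal (max 1 γ * (1 + 1 / γ + 1 / (a - γ)) * T ^ (a - α)) +
    Real.toNNReal ((γ + 1) ^ 2 * (1 + 1 / (γ + ζ) + 1 / (a - (γ + ζ))) * T ^ (a - α)),
    fun K x hx => ?_⟩
  rw [ENNReal.coe_add, add_mul]
  refine add_le_add (iSup₂_le fun y ⟨h0, hst, htτ, hτT⟩ => ?_)
    (iSup₂_le fun y ⟨h0, hst, htτ', hτ, hτT⟩ => ?_)
  · exact enorm_div_ofReal_le (by positivity) (psi1_pos hst htτ)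
      (norm_pathIntegral_le hx hst htτ (by linarith) hγ hγa hαa)
  · exact enorm_div_ofReal_le (by positivity) (psi12_pos hst htτ' hτ)
      (norm_pathIntegral_sub_pathIntegral_le hx hst htτ' hτ (by linarith) hγ hη hζ hζη hγζa hαa)

end NormedGroup

variable {Ω E : Type*} [MeasurableSpace Ω] {P : Measure Ω} [NormedAddCommGroup E]
  [MeasurableSpace E] [BorelSpace E] [SecondCountableTopology E]

lemma aemeasurable_volterraNorm {z : Ω → ℝ → ℝ → ℝ → E} (T α γ η ζ : ℝ)
    (hmeas : ∀ s t τ, (s, t, τ) ∈ simplex3 T → AEMeasurable (fun ω => z ω s t τ) P)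
    (hcont : ∀ᵐ ω ∂P,
      ContinuousOn (fun x : ℝ × ℝ × ℝ => z ω x.1 x.2.1 x.2.2) (simplex3 T)) :
    AEMeasurable (fun ω => volterraNorm T α γ η ζ (z ω)) P := by
  refine AEMeasurable.add (aemeasurable_biSup_of_continuousOn (fun x hx => ?_) ?_)
    (aemeasurable_biSup_of_continuousOn (fun x hx => ?_) ?_)
  · exact (hmeas _ _ _ hx).enorm.div_const _
  · filter_upwards [hcont] with ω hω
    exact continuousOn_enorm_div hω (continuousOn_psi1 T α γ) fun x hx => psi1_pos hx.2.1 hx.2.2.1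
  · exact ((hmeas _ _ _ (mem_simplex3_right hx)).sub
      (hmeas _ _ _ (mem_simplex3_left hx))).enorm.div_const _
  · filter_upwards [hcont] with ω hω
    refine continuousOn_enorm_div (ContinuousOn.sub ?_ ?_) (continuousOn_psi12 T α γ η ζ)
      fun x hx => psi12_pos hx.2.1 hx.2.2.1 hx.2.2.2.1
    · exact hω.comp (f := fun x : ℝ × ℝ × ℝ × ℝ => (x.1, x.2.1, x.2.2.2)) (by fun_prop)
        fun x hx => mem_simplex3_right hx
    · exact hω.comp (f := fun x : ℝ × ℝ × ℝ × ℝ => (x.1, x.2.1, x.2.2.1)) (by fun_prop)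
        fun x hx => mem_simplex3_left hx

end VolterraNorm

/-! ### The first level of the Volterra rough path -/

section FirstLevel

open scoped NNReal

variable {Ω : Type*} [MeasurableSpace Ω] {P : Measure Ω} {H T α γ : ℝ} {m : ℕ}
  {B : Set.Icc (0 : ℝ) T → Ω → EuclideanSpace ℝ (Fin m)}
  {z z' : Ω → ℝ → ℝ → ℝ → EuclideanSpace ℝ (Fin m)}

lemma IsFirstLevel.aemeasurable (hz : IsFirstLevel P H T γ B z) {s t τ : ℝ}
    (hx : (s, t, τ) ∈ simplex3 T) : AEMeasurable (fun ω => z ω s t τ) P := by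
  have hcoord : AEMeasurable (fun ω i => z ω s t τ i) P :=
    aemeasurable_pi_iff.2 fun i => (hz.wiener s t τ hx i).2.1.1.aemeasurable
  exact (PiLp.continuous_toLp 2 fun _ : Fin m => ℝ).measurable.comp_aemeasurable hcoord

lemma memLp_coe_of_lintegral_rpow_lt_top {K : Ω → ℝ≥0} {p : ℝ≥0∞} (hp : p ≠ 0) (hp' : p ≠ ∞)
    (hK : AEMeasurable K P) (hKp : ∫⁻ ω, (K ω : ℝ≥0∞) ^ p.toReal ∂P < ∞) :
    MemLp (fun ω => (K ω : ℝ)) p P := by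
  refine ⟨hK.coe_nnreal_real.aestronglyMeasurable, ?_⟩
  rw [eLpNorm_lt_top_iff_lintegral_rpow_enorm_lt_top hp hp']
  simpa only [NNReal.enorm_eq] using hKp

variable [IsProbabilityMeasure P]

lemma IsFBM.hasFBMCovariance (hB : IsFBM P H T B) (i : Fin m) :
    HasFBMCovariance P H (fun t ω => B t ω i) :=
  ⟨hB.memLp_coord i, hB.integral_mul i⟩

lemma IsFirstLevel.ae_eq (hB : IsFBM P H T B) (hH : 1 / 2 < H) (hγ : 0 < γ)
    (hz : IsFirstLevel P H T γ B z) (hz' : IsFirstLevel P H T γ B z') :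
    ∀ᵐ ω ∂P, ∀ s t τ, (s, t, τ) ∈ simplex3 T → z ω s t τ = z' ω s t τ := by
  obtain ⟨D, hDS, hD, hSD⟩ := exists_countable_subset_closure (simplex3 T)
  have hcountable : ∀ᵐ ω ∂P, ∀ x ∈ D, z ω x.1 x.2.1 x.2.2 = z' ω x.1 x.2.1 x.2.2 := by
    refine (ae_ball_iff hD).2 fun x hx => ?_
    obtain ⟨hs, hst, htτ, hτT⟩ := hDS hx
    have hcoord : ∀ i, ∀ᵐ ω ∂P, z ω x.1 x.2.1 x.2.2 i = z' ω x.1 x.2.1 x.2.2 i := fun i =>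
      (hz.wiener _ _ _ (hDS hx) i).ae_eq (hB.hasFBMCovariance i) hH
        (stepApproximable_kernel hγ hs hst.le htτ (htτ.le.trans hτT))
        (hz'.wiener _ _ _ (hDS hx) i)
    filter_upwards [ae_all_iff.2 hcoord] with ω hω
    exact PiLp.ext hω
  filter_upwards [hcountable, hz.continuous, hz'.continuous] with ω hω hc hc' s t τ hx
  exact Set.EqOn.of_subset_closure (f := fun x : ℝ × ℝ × ℝ => z ω x.1 x.2.1 x.2.2)
    (g := fun x : ℝ × ℝ × ℝ => z' ω x.1 x.2.1 x.2.2) hω hc hc' hDS hSD hx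

lemma isFirstLevel_pathIntegral {a : ℝ≥0} {x : Ω → ℝ → EuclideanSpace ℝ (Fin m)} {K : Ω → ℝ≥0}
    (hB : IsFBM P H T B) (hH : 1 / 2 < H) (hγ : 0 < γ) (ha : 0 < a)
    (hx : ∀ ω, HolderWith (K ω) a (x ω)) (hxB : ∀ t : Set.Icc (0 : ℝ) T, ∀ᵐ ω ∂P, x ω t = B t ω)
    (hK : MemLp (fun ω => (K ω : ℝ)) 2 P) :
    IsFirstLevel P H T γ B fun ω => pathIntegral γ (x ω) where
  wiener s t τ hs i := by
    obtain ⟨hs0, hst, htτ, hτT⟩ := hs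
    have hcoord : ∀ ω, pathIntegral γ (x ω) s t τ i = pathIntegral γ (fun r => x ω r i) s t τ :=
      fun ω => map_pathIntegral (EuclideanSpace.proj i) ((hx ω).continuous ha) hst.le htτ
    simp only [hcoord]
    refine isWienerIntegral_pathIntegral (hB.hasFBMCovariance i) hH ha
      (fun ω r r' => (PiLp.edist_apply_le _ _ i).trans (hx ω r r')) (fun u => ?_) hK hγ hs0 hst.le
      htτ (htτ.le.trans hτT)
    filter_upwards [hxB u] with ω hω
    rw [hω]
  continuous := ae_of_all _ fun ω => continuousOn_pathIntegral ((hx ω).continuous ha)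

lemma exists_isFirstLevel_volterraNorm_le (hT : 0 < T) (hH : 1 / 2 < H) (hγ : 0 < γ)
    (hγα : γ < α) (hαH : α < H) (hB : IsFBM P H T B) :
    ∃ (z : Ω → ℝ → ℝ → ℝ → EuclideanSpace ℝ (Fin m)) (K : Ω → ℝ≥0), IsFirstLevel P H T γ B z ∧
      (∀ q : ℝ, 0 ≤ q → ∫⁻ ω, (K ω : ℝ≥0∞) ^ q ∂P < ∞) ∧
      ∀ η ζ : ℝ, 0 ≤ ζ → ζ ≤ min (α - γ) η → η ≤ 1 →
        ∃ C : ℝ≥0, ∀ ω, volterraNorm T α γ η ζ (z ω) ≤ C * K ω := by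
  obtain ⟨a, hαa, haH⟩ := exists_between hαH
  have ha : 0 < a := (hγ.trans hγα).trans hαa
  lift a to ℝ≥0 using ha.le
  obtain ⟨x, K, hx, hxB, hK, hKq⟩ := exists_holderWith_modification_Icc hT
    (NNReal.coe_pos.1 ha) haH fun p hp => hB.exists_isAEKolmogorovProcess (by linarith) hp
  refine ⟨fun ω => pathIntegral γ (x ω), K,
    isFirstLevel_pathIntegral hB hH hγ (NNReal.coe_pos.1 ha) hx hxB
      (memLp_coe_of_lintegral_rpow_lt_top two_ne_zero ENNReal.ofNat_ne_top hK
        (hKq _ ENNReal.toReal_nonneg)), hKq, fun η ζ hζ hζη hη => ?_⟩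
  obtain ⟨hζρ, hζη⟩ := le_min_iff.1 hζη
  obtain ⟨C, hC⟩ := exists_volterraNorm_pathIntegral_le (E := EuclideanSpace ℝ (Fin m))
    hT.le hγ hζ hζη hη (by linarith : γ + ζ < a) hαa.le
  exact ⟨C, fun ω => hC (K ω) (x ω) (hx ω)⟩

end FirstLevel

end VolterraFBM

open VolterraFBM in
theorem mainTheorem6_general {Ω : Type*} [MeasurableSpace Ω] {P : Measure Ω}
    [IsProbabilityMeasure P] {m : ℕ} {T H α γ : ℝ} (hT : 0 < T) (hH : 1 / 2 < H) (hγ : 0 < γ)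
    (hγα : γ < α) (hαH : α < H) {B : Set.Icc (0 : ℝ) T → Ω → EuclideanSpace ℝ (Fin m)}
    (hB : IsFBM P H T B) :
    (∃ z, IsFirstLevel P H T γ B z) ∧
    ∀ z, IsFirstLevel P H T γ B z →
      (∀ᵐ ω ∂P, ∀ η ζ : ℝ, 0 ≤ ζ → ζ ≤ min (α - γ) η → η ≤ 1 →
        z ω ∈ volterraSpace (EuclideanSpace ℝ (Fin m)) T α γ η ζ) ∧
      ∀ η ζ : ℝ, 0 ≤ ζ → ζ ≤ min (α - γ) η → η ≤ 1 →
        AEMeasurable (fun ω => volterraNorm T α γ η ζ (z ω)) P ∧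
        ∀ q : ℝ, 0 ≤ q → ∫⁻ ω, volterraNorm T α γ η ζ (z ω) ^ q ∂P < ∞ := by
  obtain ⟨z₀, K, hz₀, hK, hle⟩ := exists_isFirstLevel_volterraNorm_le hT hH hγ hγα hαH hB
  refine ⟨⟨z₀, hz₀⟩, fun z hz => ?_⟩
  have heq : ∀ᵐ ω ∂P, ∀ η ζ, volterraNorm T α γ η ζ (z ω) = volterraNorm T α γ η ζ (z₀ ω) :=
    (hz.ae_eq hB hH hγ hz₀).mono fun ω hω η ζ => volterraNorm_congr hω
  refine ⟨?_, fun η ζ hζ hζη hη => ⟨aemeasurable_volterraNorm T α γ η ζ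
    (fun _ _ _ hx => hz.aemeasurable hx) hz.continuous, fun q hq => ?_⟩⟩
  · filter_upwards [heq] with ω hω η ζ hζ hζη hη
    obtain ⟨C, hC⟩ := hle η ζ hζ hζη hη
    exact ((hω η ζ).trans_le (hC ω)).trans_lt (ENNReal.mul_lt_top ENNReal.coe_lt_top
      ENNReal.coe_lt_top)
  · obtain ⟨C, hC⟩ := hle η ζ hζ hζη hη
    calc ∫⁻ ω, volterraNorm T α γ η ζ (z ω) ^ q ∂P ≤ ∫⁻ ω, (C : ℝ≥0∞) ^ q * K ω ^ q ∂P := by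
          refine lintegral_mono_ae (heq.mono fun ω hω => ?_)
          rw [← ENNReal.mul_rpow_of_nonneg _ _ hq, hω]
          exact ENNReal.rpow_le_rpow (hC ω) hq
      _ = (C : ℝ≥0∞) ^ q * ∫⁻ ω, (K ω : ℝ≥0∞) ^ q ∂P :=
          lintegral_const_mul' _ _ (ENNReal.rpow_ne_top_of_nonneg hq ENNReal.coe_ne_top)
      _ < ∞ := ENNReal.mul_lt_top (ENNReal.rpow_lt_top_of_nonneg hq ENNReal.coe_ne_top) (hK q hq)

theorem mainTheorem6 {Ω : Type*} [MeasurableSpace Ω] (P : Measure Ω) [IsProbabilityMeasure P]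
    (m : ℕ) (T H α γ : ℝ) (hT : 0 < T)
    (hH : H ∈ Set.Ioo (1 / 2 : ℝ) 1) (hα : α ∈ Set.Ioo 0 H) (hγ : γ ∈ Set.Ioo 0 (2 * H - 1))
    (hρ : 0 < α - γ)
    (N : ℕ) (η ζ : Fin N → ℝ)
    (hη : ∀ k, η k ∈ Set.Icc (0 : ℝ) 1)
    (hζ : ∀ k, 0 ≤ ζ k ∧ ζ k ≤ min (α - γ) (η k)) (hηα : ∀ k, 1 - α < η k)
    (B : Set.Icc (0 : ℝ) T → Ω → EuclideanSpace ℝ (Fin m)) (hB : VolterraFBM.IsFBM P H T B) :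
    (∃ z, VolterraFBM.IsFirstLevel P H T γ B z) ∧
    ∀ z, VolterraFBM.IsFirstLevel P H T γ B z →
      (∀ᵐ ω ∂P, ∀ k, z ω ∈
        VolterraFBM.volterraSpace (EuclideanSpace ℝ (Fin m)) T α γ (η k) (ζ k)) ∧
      ∀ k, AEMeasurable (fun ω => VolterraFBM.volterraNorm T α γ (η k) (ζ k) (z ω)) P ∧
        ∀ p : ℝ, 1 ≤ p →
          ∫⁻ ω, VolterraFBM.volterraNorm T α γ (η k) (ζ k) (z ω) ^ (2 * p) ∂P < ∞ :=
  have ⟨hexists, hall⟩ := mainTheorem6_general hT hH.1 hγ.1 (sub_pos.1 hρ) hα.2 hB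
  ⟨hexists, fun z hz => ⟨(hall z hz).1.mono fun ω hω k => hω _ _ (hζ k).1 (hζ k).2 (hη k).2,
    fun k => ((hall z hz).2 _ _ (hζ k).1 (hζ k).2 (hη k).2).imp_right
      fun hmoment p _ => hmoment (2 * p) (by linarith)⟩⟩
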